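/- **Setting.** Let $\mathbb G=(\mathbb R^{N},\circ,\delta_\lambda)$ be a homogeneous Carnot group: $\circ$ is a Lie group law on $\mathbb R^{N}=\mathbb R^{N_1}\times\dots\times\mathbb R^{N_r}$ (neutral element $0$), the dilations $\delta_\lambda(x^{(1)},\dots,x^{(r)})=(\lambda x^{(1)},\dots,\lambda^r x^{(r)})$, $\lambda>0$, are group automorphisms, and the iterated commutators of the left-invariant vector fields $X_1,\dots,X_{N_1}$ with $X_k(0)=\partial/\partial x^{(1)}_k$ span $\mathbb R^{N}$ at every point. Let $d\nu=dx_1\wedge\dots\wedge dx_N$ be the volume form (also written for the Lebesgue measure), and let $\langle X_k,d\nu\rangle=d\nu(X_k,\cdot,\dots,\cdot)$ be its contraction with $X_k$, an $(N-1)$-form. An *admissible domain* is a bounded open set $\Omega\subset\mathbb R^N$ with piecewise smooth simple boundary: $\partial\Omega=\bigcup_{i}\varphi_i(K_i)$ for finitely many compact sets $K_i\subset\mathbb R^{N-1}$ whose topological boundaries are Lebesgue-null, and maps $\varphi_i$ that are smooth up to the boundary of $K_i$, such that the $\varphi_i$ are injective on, and have pairwise disjoint images of, the interiors of the $K_i$,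 and such that near each $\varphi_i(u)$, $u$ in the interior of $K_i$, the set $\Omega$ is of the form $\{\rho<0\}$ with $\rho$ smooth and $(\nabla\rho(\varphi_i(u)),\partial_1\varphi_i(u),\dots,\partial_{N-1}\varphi_i(u))$ a positively oriented basis. For an $(N-1)$-form $\omega$ put $\int_{\partial\Omega}\omega=\sum_i\int_{K_i}\omega_{\varphi_i(u)}(\partial_1\varphi_i(u),\dots,\partial_{N-1}\varphi_i(u))\,du$. **Proposition 2.2 (Divergence formula).** There are polynomials $a^{(l)}_{k,m}(x^{(1)},\dots,x^{(l-1)})$ ($1\le k\le N_1$, $2\le l\le r$, $1\le m\le N_l$), $\delta_\lambda$-homogeneous of degree $l-1$, such that $$X_k=\frac{\partial}{\partial x^{(1)}_k}+\sum_{l=2}^r\sum_{m=1}^{N_l}a^{(l)}_{k,m}(x^{(1)},\dots,x^{(l-1)})\frac{\partial}{\partial x^{(l)}_m},\qquad k=1,\dots,N_1,$$ and, with $\theta_{l,m}=-\sum_{k=1}^{N_1}a^{(l)}_{k,m}\,dx^{(1)}_k+dx^{(l)}_m$, $$\langle X_k,d\nu\rangle=(-1)^{k-1}\bigwedge_{j=1,\,j\ne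 k}^{N_1}dx^{(1)}_j\wedge\bigwedge_{l=2}^r\bigwedge_{m=1}^{N_l}\theta_{l,m},\qquad k=1,\dots,N_1.$$ Moreover, for every admissible domain $\Omega$ and all real- or complex-valued functions $f_1,\dots,f_{N_1}\in C^1(\Omega)\cap C(\overline\Omega)$ the boundary integrals below converge absolutely; for each $k$ such that $X_kf_k$ is integrable over $\Omega$, $$\int_\Omega X_kf_k\,d\nu=\int_{\partial\Omega}f_k\,\langle X_k,d\nu\rangle,$$ and, whenever $\sum_{k=1}^{N_1}X_kf_k$ is integrable over $\Omega$, $$\int_\Omega\sum_{k=1}^{N_1}X_kf_k\,d\nu=\int_{\partial\Omega}\sum_{k=1}^{N_1}f_k\,\langle X_k,d\nu\rangle.$$ -/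

import Mathlib

open MeasureTheory
open scoped ContDiff

noncomputable section

namespace Carnot

/-- Euclidean space `ℝ^d`, with its Lebesgue measure `volume`. -/
abbrev E (d : ℕ) : Type := EuclideanSpace ℝ (Fin d)

/-- The `i`-th standard unit vector `∂/∂x_i`. -/
def stdVec {d : ℕ} (i : Fin d) : E d := EuclideanSpace.single i 1

/-- The `i`-th coordinate covector `dx_i`. -/
def dx {d : ℕ} (i : Fin d) : E d →ₗ[ℝ] ℝ := (EuclideanSpace.proj i : E d →L[ℝ] ℝ).toLinearMap

/-- The wedge product `η_1 ∧ … ∧ η_m` of covectors, in the normalisation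
`(η_1 ∧ … ∧ η_m)(v_1, …, v_m) = det (η_j (v_i))`. -/
def wedge {d m : ℕ} (η : Fin m → E d →ₗ[ℝ] ℝ) : E d [⋀^Fin m]→ₗ[ℝ] ℝ :=
  Matrix.detRowAlternating.compLinearMap (LinearMap.pi η)

theorem wedge_apply {d m : ℕ} (η : Fin m → E d →ₗ[ℝ] ℝ) (v : Fin m → E d) :
    wedge η v = Matrix.det (Matrix.of fun i j => η j (v i)) := rfl

/-- The volume form `dν = dx_1 ∧ … ∧ dx_d`. -/
def volForm (d : ℕ) : E d [⋀^Fin d]→ₗ[ℝ] ℝ := wedge fun i => dx i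

/-- The natural pairing (contraction) `⟨X, dν⟩` of a vector field `X` on `ℝ^{n+1}` with the volume
form: the `n`-form `(v_1, …, v_n) ↦ dν (X, v_1, …, v_n)`. -/
def contractVol {n : ℕ} (X : E (n + 1) → E (n + 1)) (x : E (n + 1)) :
    E (n + 1) [⋀^Fin n]→ₗ[ℝ] ℝ :=
  (volForm (n + 1)).curryLeft (X x)

/-- The product `f η` of a (vector-valued) function and a real differential form. -/
def mulForm {d m : ℕ} {F : Type*} [NormedAddCommGroup F] [NormedSpace ℝ F]
    (f : E d → F) (η : E d → E d [⋀^Fin m]→ₗ[ℝ] ℝ) (x : E d) : E d [⋀^Fin m]→ₗ[ℝ] F :=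
  (LinearMap.toSpanSingleton ℝ F (f x)).compAlternatingMap (η x)

/-- A homogeneous Lie group on `ℝ^N`, `N = n + 1`. The decomposition
`ℝ^N = ℝ^{N_1} × … × ℝ^{N_r}` is encoded by the nondecreasing sequence of weights: `weight i = l`
says that the `i`-th coordinate belongs to the `l`-th factor, so that
`N_l = #{i | weight i = l}` and `δ_λ (x^{(1)}, …, x^{(r)}) = (λ x^{(1)}, …, λ^r x^{(r)})` multiplies
the `i`-th coordinate by `λ ^ weight i`. The neutral element is the origin, which is the only
fixed point of the dilations. -/
structure HomogeneousGroup (n : ℕ) where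
  weight : Fin (n + 1) → ℕ
  weight_mono : Monotone weight
  weight_pos : ∀ i, 1 ≤ weight i
  op : E (n + 1) → E (n + 1) → E (n + 1)
  inv : E (n + 1) → E (n + 1)
  op_assoc : ∀ x y z, op (op x y) z = op x (op y z)
  zero_op : ∀ x, op 0 x = x
  op_zero : ∀ x, op x 0 = x
  inv_op : ∀ x, op (inv x) x = 0
  contDiff_op : ContDiff ℝ ∞ (fun p : E (n + 1) × E (n + 1) => op p.1 p.2)
  contDiff_inv : ContDiff ℝ ∞ inv
  /-- Every dilation `δ_c`, `c > 0`, is an automorphism of the group. -/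
  dilation_op : ∀ c : ℝ, 0 < c → ∀ x y,
    (WithLp.toLp 2 fun i => c ^ weight i * op x y i : E (n + 1)) =
      op (WithLp.toLp 2 fun i => c ^ weight i * x i) (WithLp.toLp 2 fun i => c ^ weight i * y i)

namespace HomogeneousGroup

variable {n : ℕ}

/-- The indices `1, …, N_1` of the coordinates in the first stratum. -/
abbrev Horizontal (G : HomogeneousGroup n) : Type := {k : Fin (n + 1) // G.weight k = 1}

/-- The indices `(l, m)`, `l ≥ 2`, of the coordinates in the higher strata. -/
abbrev Vertical (G : HomogeneousGroup n) : Type := {i : Fin (n + 1) // 2 ≤ G.weight i}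

/-- The left-invariant vector field `X_k` with `X_k (0) = ∂/∂x_k`: its value at `x` is the image of
`∂/∂x_k` under the differential at the origin of the left translation `y ↦ x ∘ y`. -/
def X (G : HomogeneousGroup n) (k : G.Horizontal) (x : E (n + 1)) : E (n + 1) :=
  fderiv ℝ (fun y => G.op x y) 0 (stdVec k.1)

end HomogeneousGroup

/-- The iterated commutators of a family of vector fields. -/
inductive IsIteratedCommutator {d : ℕ} {ι : Type} (X : ι → E d → E d) : (E d → E d) → Prop
  | of (k : ι) : IsIteratedCommutator X (X k)
  | bracket (V W : E d → E d) (hV : IsIteratedCommutator X V) (hW : IsIteratedCommutator X W) :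
      IsIteratedCommutator X (VectorField.lieBracket ℝ V W)

/-- A homogeneous Carnot group on `ℝ^{n+1}`: a homogeneous Lie group such that the iterated
commutators of `X_1, …, X_{N_1}` span the tangent space at every point. -/
structure CarnotGroup (n : ℕ) extends HomogeneousGroup n where
  generating : ∀ x : E (n + 1),
    Submodule.span ℝ {v | ∃ V, IsIteratedCommutator toHomogeneousGroup.X V ∧ V x = v} = ⊤

namespace CarnotGroup

variable {n : ℕ}

/-- The covectors at `x` whose wedge is considered: `dx_j` for `j` in the first stratum, and
`θ_i = - ∑_k a_{k,i}(x) dx_k + dx_i` (sum over the first stratum) for `i` in a higher stratum. -/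
def coframe (G : CarnotGroup n) (a : G.Horizontal → G.Vertical → MvPolynomial (Fin (n + 1)) ℝ)
    (x : E (n + 1)) (i : Fin (n + 1)) : E (n + 1) →ₗ[ℝ] ℝ :=
  if h : 2 ≤ G.weight i then
    -(∑ k : G.Horizontal, MvPolynomial.eval (fun j => x j) (a k ⟨i, h⟩) • dx k.1) + dx i
  else dx i

/-- The derivative `X_k f`. -/
def derivX {F : Type*} [NormedAddCommGroup F] [NormedSpace ℝ F] (G : CarnotGroup n)
    (k : G.Horizontal) (f : E (n + 1) → F) (x : E (n + 1)) : F :=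
  fderiv ℝ f x (G.X k x)

end CarnotGroup

/-- A bounded open set `Ω ⊆ ℝ^{n+1}` whose boundary is piecewise smooth and simple, together with
a positively oriented parametrisation of its boundary by finitely many smooth pieces. -/
structure AdmissibleDomain (n : ℕ) where
  /-- The set `Ω`. -/
  carrier : Set (E (n + 1))
  isOpen : IsOpen carrier
  isBounded : Bornology.IsBounded carrier
  /-- The number of smooth pieces of `∂Ω`. -/
  pieces : ℕ
  /-- The compact parameter region of each piece. -/
  dom : Fin pieces → Set (E n)
  /-- The parametrisation of each piece. -/
  param : Fin pieces → E n → E (n + 1)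
  isCompact_dom : ∀ i, IsCompact (dom i)
  volume_frontier_dom : ∀ i, volume (frontier (dom i)) = 0
  /-- The parametrisations are smooth up to the edges of the pieces. -/
  contDiffAt_param : ∀ i, ∀ u ∈ dom i, ContDiffAt ℝ ∞ (param i) u
  /-- The boundary of `Ω` is the union of the pieces. -/
  frontier_eq : frontier carrier = ⋃ i, param i '' dom i
  /-- The boundary is simple: pieces do not meet themselves or each other, except at edges. -/
  simple : ∀ i j, ∀ u ∈ interior (dom i), ∀ v ∈ interior (dom j),
    param i u = param j v → i = j ∧ u = v
  /-- Off the edges, `Ω` lies locally on one side `{ρ < 0}` of a smooth hypersurface `{ρ = 0}`, and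
  the outward normal `∇ρ` followed by the partial derivatives of the parametrisation is a
  positively oriented basis (so that the parametrisation is regular and induces the boundary
  orientation). -/
  oriented : ∀ i, ∀ u ∈ interior (dom i), ∃ (V : Set (E (n + 1))) (ρ : E (n + 1) → ℝ),
    IsOpen V ∧ param i u ∈ V ∧ ContDiffOn ℝ ∞ ρ V ∧
      carrier ∩ V = {y | ρ y < 0} ∩ V ∧
      0 < volForm (n + 1) (Fin.cons (gradient ρ (param i u))
        (fun j : Fin n => fderiv ℝ (param i) u (stdVec j)))

namespace AdmissibleDomain

variable {n : ℕ} {F : Type*} [NormedAddCommGroup F] [NormedSpace ℝ F]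

/-- The coefficient of the pull-back of an `n`-form `η` by the parametrisation of the `i`-th piece of
the boundary: `u ↦ η (∂_1 φ, …, ∂_n φ)` at the point `φ u`. -/
def pullback (Ω : AdmissibleDomain n) (η : E (n + 1) → E (n + 1) [⋀^Fin n]→ₗ[ℝ] F)
    (i : Fin Ω.pieces) (u : E n) : F :=
  η (Ω.param i u) (fun j : Fin n => fderiv ℝ (Ω.param i) u (stdVec j))

/-- The pull-backs of the form `η` to all pieces of the boundary are integrable. -/
def FormIntegrable (Ω : AdmissibleDomain n)
    (η : E (n + 1) → E (n + 1) [⋀^Fin n]→ₗ[ℝ] F) : Prop :=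
  ∀ i, IntegrableOn (Ω.pullback η i) (Ω.dom i)

/-- The integral `∫_{∂Ω} η` of an `n`-form over the oriented boundary of `Ω`. -/
def boundaryIntegral (Ω : AdmissibleDomain n)
    (η : E (n + 1) → E (n + 1) [⋀^Fin n]→ₗ[ℝ] F) : F :=
  ∑ i, ∫ u in Ω.dom i, Ω.pullback η i u

end AdmissibleDomain

end Carnot

end

open Filter Topology

noncomputable section

namespace Carnot

/-! Algebraic part. Differentiating δ_c (x ∘ y) = δ_c x ∘ δ_c y at y = 0 shows that the component of
`X_k` of weight l is smooth and homogeneous of degree l - 1. A smooth homogeneous function is a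
polynomial, by induction on the degree through Euler's identity
(`exists_mvPolynomial_of_homogeneous`). The covectors dx_j, θ_i form a unitriangular coframe on
which `X_k` takes the values of a unit vector; expanding the determinant gives ⟨X_k, dν⟩
(`contractVol_X`). A coefficient of degree l - 1 involves only variables of weight below l, hence is
constant in the direction it multiplies, and `X_k` is divergence free (`integral_fderiv_X_eq_zero`).

Analytic part. The functions are C^1 inside Ω but only continuous up to the boundary, so ∑ X_k f_k
is regarded as the weak divergence of F = ∑ f_k X_k (`isWeakDiv_fieldOf`), and the formula is proved
for continuous fields with integrable weak divergence (`integral_weakDiv`). Near a regular boundary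
point, in coordinates (t, u) ↦ φ(u) + t w, the set Ω is t < 0. Testing with ψ times a step in t, and
letting the step steepen, turns the derivative of the step into the flux through t = 0
(`BoundaryChart.integral_eq`). A partition of unity gives the formula for every ψ vanishing near the
edges (`testFormula`).

The edges are Lipschitz images in ℝ^{n+1} of compact null subsets of ℝ^n. They are covered by
finitely many balls of a common radius R for which the sum of R^n is arbitrarily small, so they can
be cut off by functions whose gradients are arbitrarily small in L^1 (`hasSmallCutoffs_image`). As F
is bounded on Ω, the cutoff disappears in the limit; in the boundary integral this works because
almost no parameter is mapped to an edge (`ae_param_notMem_edges`). -/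

theorem stdVec_apply {d : ℕ} (i j : Fin d) : (stdVec i : E d) j = if j = i then 1 else 0 := by
  simp [stdVec]

theorem sum_smul_stdVec {d : ℕ} (x : E d) : ∑ i, x i • (stdVec i : E d) = x := by
  ext j
  simp [stdVec_apply]

/-! ### Smooth homogeneous functions are polynomials -/

/-- The dilation of `ℝ^d` by `c` with the given weights. -/
def dilation {d : ℕ} (w : Fin d → ℕ) (c : ℝ) : E d →L[ℝ] E d :=
  LinearMap.toContinuousLinearMap
    { toFun := fun x => WithLp.toLp 2 fun i => c ^ w i * x i
      map_add' := fun x y => by ext i; simp [mul_add]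
      map_smul' := fun r x => by ext i; simp; ring }

theorem dilation_apply {d : ℕ} (w : Fin d → ℕ) (c : ℝ) (x : E d) :
    dilation w c x = WithLp.toLp 2 fun i => c ^ w i * x i := rfl

theorem dilation_eq_sum {d : ℕ} (w : Fin d → ℕ) (c : ℝ) (x : E d) :
    dilation w c x = ∑ i, (c ^ w i * x i) • (stdVec i : E d) := by
  ext j
  simp [stdVec_apply, dilation_apply]

theorem dilation_stdVec {d : ℕ} (w : Fin d → ℕ) (c : ℝ) (i : Fin d) :
    dilation w c (stdVec i) = c ^ w i • (stdVec i : E d) := by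
  ext j
  simp only [dilation_apply, stdVec_apply, PiLp.smul_apply, smul_eq_mul]
  split_ifs with h
  · rw [h]
  · simp

theorem continuous_dilation {d : ℕ} (w : Fin d → ℕ) (x : E d) :
    Continuous fun c => dilation w c x := by
  simp only [dilation_eq_sum]
  fun_prop

theorem dilation_zero {d : ℕ} {w : Fin d → ℕ} (hw : ∀ i, 1 ≤ w i) (x : E d) :
    dilation w 0 x = 0 := by
  ext j
  have : w j ≠ 0 := by have := hw j; omega
  simp [dilation_apply, this]

theorem hasDerivAt_dilation {d : ℕ} (w : Fin d → ℕ) (x : E d) :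
    HasDerivAt (fun c => dilation w c x) (∑ i, (w i * x i) • (stdVec i : E d)) 1 := by
  simp only [dilation_eq_sum]
  refine HasDerivAt.fun_sum fun i _ => ?_
  have h := ((hasDerivAt_pow (w i) (1 : ℝ)).mul_const (x i)).smul_const (stdVec i : E d)
  simpa using h

/-- A continuous function which is homogeneous of negative degree vanishes, as does the increment of
a function which is homogeneous of degree zero. -/
theorem eq_of_dilation_pow_mul {d : ℕ} {w : Fin d → ℕ} (hw : ∀ i, 1 ≤ w i) {b : E d → ℝ}
    (hb : Continuous b) {k : ℕ} (h : ∀ c : ℝ, 0 < c → ∀ x, c ^ k * b (dilation w c x) = b x)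
    (x : E d) : b x = 0 ^ k * b 0 := by
  -- Let c tend to 0 from the right in the homogeneity relation. As 0 ^ 0 = 1, a single formula
  -- covers degree zero (k = 0) and negative degree (k > 0).
  have hc : Continuous fun c : ℝ => c ^ k * b (dilation w c x) :=
    (continuous_pow k).mul (hb.comp (continuous_dilation w x))
  have h1 : Tendsto (fun c : ℝ => c ^ k * b (dilation w c x)) (𝓝[>] 0) (𝓝 (0 ^ k * b 0)) := by
    have := hc.tendsto 0
    rw [dilation_zero hw] at this
    exact this.mono_left nhdsWithin_le_nhds
  have h2 : Tendsto (fun c : ℝ => c ^ k * b (dilation w c x)) (𝓝[>] 0) (𝓝 (b x)) :=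
    tendsto_const_nhds.congr' (by
      filter_upwards [self_mem_nhdsWithin] with c hc
      exact (h c hc x).symm)
  exact tendsto_nhds_unique h2 h1

/-- A smooth function which is homogeneous with respect to dilations of positive weights is a
weighted homogeneous polynomial. -/
theorem exists_mvPolynomial_of_homogeneous {d : ℕ} {w : Fin d → ℕ} (hw : ∀ i, 1 ≤ w i) (m : ℕ) :
    ∀ a : E d → ℝ, ContDiff ℝ ∞ a → (∀ c : ℝ, 0 < c → ∀ x, a (dilation w c x) = c ^ m * a x) →
      ∃ p : MvPolynomial (Fin d) ℝ, p.IsWeightedHomogeneous w m ∧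
        ∀ x, a x = MvPolynomial.eval (fun j => x j) p := by
  induction m using Nat.strong_induction_on with
  | _ m ih =>
  intro a ha hom
  rcases Nat.eq_zero_or_pos m with rfl | hm
  · refine ⟨MvPolynomial.C (a 0), MvPolynomial.isWeightedHomogeneous_C w _, fun x => ?_⟩
    have := eq_of_dilation_pow_mul hw ha.continuous (k := 0)
      (fun c hc x => by simpa using hom c hc x) x
    simpa using this
  -- The derivative ∂_j a has degree m - w_j. Keeping c ^ w_j on the left avoids a subtraction,
  -- which would be wrong when w_j > m.
  have hder : ∀ j (c : ℝ), 0 < c → ∀ x, c ^ w j * fderiv ℝ a (dilation w c x) (stdVec j)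
      = c ^ m * fderiv ℝ a x (stdVec j) := by
    intro j c hc x
    have hd : Differentiable ℝ a := ha.differentiable (by simp)
    have h1 : HasFDerivAt (fun y => a (dilation w c y))
        ((fderiv ℝ a (dilation w c x)).comp (dilation w c)) x :=
      (hd _).hasFDerivAt.comp x (dilation w c).hasFDerivAt
    have h2 : HasFDerivAt (fun y => c ^ m * a y) (c ^ m • fderiv ℝ a x) x :=
      (hd x).hasFDerivAt.const_mul _
    have h3 := h1.unique (by simpa only [hom c hc] using h2)
    have h4 := congrArg (fun T => T (stdVec j)) h3
    simpa [dilation_stdVec] using h4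
  have hsm : ∀ j, ContDiff ℝ ∞ fun x => fderiv ℝ a x (stdVec j) := fun j =>
    (ha.fderiv_right (m := ∞) (by simp)).clm_apply contDiff_const
  -- Homogeneity is asserted for X_j p instead of p, so that the case w_j > m, where p = 0, needs no
  -- negative degree.
  have hp : ∀ j, ∃ p : MvPolynomial (Fin d) ℝ,
      (MvPolynomial.X j * p).IsWeightedHomogeneous w m ∧
        ∀ x : E d, fderiv ℝ a x (stdVec j) = MvPolynomial.eval (fun j => x j) p := by
    intro j
    have hj := hw j
    rcases le_or_gt (w j) m with hjm | hjm
    · obtain ⟨p, hp, hpe⟩ := ih (m - w j) (by omega) _ (hsm j) (fun c hc x => by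
        have h := hder j c hc x
        have hc' : c ^ w j ≠ 0 := by positivity
        apply mul_left_cancel₀ hc'
        rw [h, ← mul_assoc, ← pow_add, Nat.add_sub_cancel' hjm])
      refine ⟨p, ?_, hpe⟩
      have := (MvPolynomial.isWeightedHomogeneous_X ℝ w j).mul hp
      rwa [Nat.add_sub_cancel' hjm] at this
    · refine ⟨0, by simpa using MvPolynomial.isWeightedHomogeneous_zero ℝ w m, fun x => ?_⟩
      have := eq_of_dilation_pow_mul hw (hsm j).continuous (k := w j - m) (fun c hc x => by
        have h := hder j c hc x
        have hc' : c ^ m ≠ 0 := by positivity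
        apply mul_left_cancel₀ hc'
        rw [← h, ← mul_assoc, ← pow_add, Nat.add_sub_cancel' hjm.le]) x
      rw [this]
      have : w j - m ≠ 0 := by omega
      simp [this]
  choose p hpw hpe using hp
  -- Euler's identity m a = ∑ w_j x_j ∂_j a, obtained below by differentiating c ↦ a (δ_c x) at c =
  -- 1.
  refine ⟨MvPolynomial.C (m : ℝ)⁻¹ * ∑ j, MvPolynomial.C (w j : ℝ) * (MvPolynomial.X j * p j),
    ?_, fun x => ?_⟩
  · have h0 := (MvPolynomial.isWeightedHomogeneous_C (R := ℝ) w (m : ℝ)⁻¹).mul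
      (MvPolynomial.IsWeightedHomogeneous.sum Finset.univ
        (fun j => MvPolynomial.C (w j : ℝ) * (MvPolynomial.X j * p j)) m (fun j _ => by
          have := (MvPolynomial.isWeightedHomogeneous_C (R := ℝ) w (w j : ℝ)).mul (hpw j)
          rwa [zero_add] at this))
    rwa [zero_add] at h0
  · have hd : Differentiable ℝ a := ha.differentiable (by simp)
    have h1 : HasDerivAt (fun c : ℝ => a (dilation w c x))
        (fderiv ℝ a x (∑ i, (w i * x i) • (stdVec i : E d))) 1 := by
      have hx : dilation w 1 x = x := by ext j; simp [dilation_apply]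
      have := (hd (dilation w 1 x)).hasFDerivAt.comp_hasDerivAt 1 (hasDerivAt_dilation w x)
      rwa [hx] at this
    have h2 : HasDerivAt (fun c : ℝ => c ^ m * a x) (m * a x) 1 := by
      simpa using (hasDerivAt_pow m (1 : ℝ)).mul_const (a x)
    have h3 : HasDerivAt (fun c : ℝ => a (dilation w c x)) (m * a x) 1 := by
      refine h2.congr_of_eventuallyEq ?_
      filter_upwards [lt_mem_nhds (zero_lt_one (α := ℝ))] with c hc
      exact hom c hc x
    have h4 := h1.unique h3
    have hm' : (m : ℝ) ≠ 0 := by exact_mod_cast hm.ne'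
    simp only [map_mul, map_sum, MvPolynomial.eval_C, MvPolynomial.eval_X, ← hpe]
    rw [eq_inv_mul_iff_mul_eq₀ hm', ← h4]
    simp [mul_assoc]

/-- The variables of a weighted homogeneous polynomial have weight at most its degree. -/
theorem weight_le_of_mem_vars {d m : ℕ} {w : Fin d → ℕ} {p : MvPolynomial (Fin d) ℝ}
    (hp : p.IsWeightedHomogeneous w m) {j : Fin d} (hj : j ∈ p.vars) : w j ≤ m := by
  rw [MvPolynomial.mem_vars_iff_mem_support] at hj
  obtain ⟨s, hs, hjs⟩ := hj
  rw [← hp (MvPolynomial.mem_support_iff.1 hs)]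
  exact Finsupp.le_weight_of_ne_zero' w (Finsupp.mem_support_iff.1 hjs)

/-! ### The fields X_k in coordinates -/

namespace HomogeneousGroup

variable {n : ℕ}

theorem contDiff_X (G : HomogeneousGroup n) (k : G.Horizontal) : ContDiff ℝ ∞ (G.X k) := by
  have h : ContDiff ℝ ∞ fun x => fderiv ℝ (fun y => G.op x y) (0 : E (n + 1)) :=
    ContDiff.fderiv (n := ∞) (f := fun x y => G.op x y) G.contDiff_op contDiff_const (by simp)
  exact h.clm_apply contDiff_const

theorem X_zero (G : HomogeneousGroup n) (k : G.Horizontal) : G.X k 0 = stdVec k.1 := by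
  have : (fun y => G.op 0 y) = id := funext G.zero_op
  simp [X, this]

/-- Differentiate δ_c (x ∘ y) = δ_c x ∘ δ_c y at y = 0 along ∂/∂x_k. The factor c on the left is δ_c
acting on a direction of weight 1. -/
theorem X_dilation (G : HomogeneousGroup n) (k : G.Horizontal) {c : ℝ} (hc : 0 < c)
    (x : E (n + 1)) : c • G.X k (dilation G.weight c x) = dilation G.weight c (G.X k x) := by
  have hd : ∀ x, Differentiable ℝ fun y => G.op x y := fun x =>
    (G.contDiff_op.comp (contDiff_const.prodMk contDiff_id)).differentiable (by simp)
  have h1 : HasFDerivAt (fun y => G.op (dilation G.weight c x) (dilation G.weight c y))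
      ((fderiv ℝ (fun y => G.op (dilation G.weight c x) y) 0).comp (dilation G.weight c)) 0 := by
    have := (hd (dilation G.weight c x) (dilation G.weight c 0)).hasFDerivAt.comp 0
      (dilation G.weight c).hasFDerivAt
    rwa [map_zero] at this
  have h2 : HasFDerivAt (fun y => dilation G.weight c (G.op x y))
      ((dilation G.weight c).comp (fderiv ℝ (fun y => G.op x y) 0)) 0 :=
    (dilation G.weight c).hasFDerivAt.comp 0 (hd x 0).hasFDerivAt
  have h3 : (fun y => dilation G.weight c (G.op x y)) =
      fun y => G.op (dilation G.weight c x) (dilation G.weight c y) :=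
    funext fun y => G.dilation_op c hc x y
  rw [h3] at h2
  have h4 := congrArg (fun T => T (stdVec k.1)) (h1.unique h2)
  simpa [dilation_stdVec, k.2, X] using h4

/-- The components of the fields `X_k` in the higher strata are homogeneous polynomials. -/
theorem exists_polynomial_X (G : HomogeneousGroup n) (k : G.Horizontal) (i : Fin (n + 1)) :
    ∃ p : MvPolynomial (Fin (n + 1)) ℝ, p.IsWeightedHomogeneous G.weight (G.weight i - 1) ∧
      ∀ x, G.X k x i = MvPolynomial.eval (fun j => x j) p := by
  refine exists_mvPolynomial_of_homogeneous G.weight_pos _ (fun x => G.X k x i) ?_ ?_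
  · exact (EuclideanSpace.proj (𝕜 := ℝ) i : E (n + 1) →L[ℝ] ℝ).contDiff.comp (G.contDiff_X k)
  · intro c hc x
    have h := congrArg (fun v : E (n + 1) => v i) (G.X_dilation k hc x)
    simp only [PiLp.smul_apply, smul_eq_mul, dilation_apply] at h
    have := G.weight_pos i
    obtain ⟨m, hm⟩ : ∃ m, G.weight i = m + 1 := ⟨G.weight i - 1, by omega⟩
    rw [hm, pow_succ', mul_assoc] at h
    rw [hm, Nat.add_sub_cancel]
    exact mul_left_cancel₀ hc.ne' h

/-- The component is a polynomial of weighted degree 0; all weights being positive, it has no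
variables and keeps its value at the origin. -/
theorem X_apply_of_weight_eq_one (G : HomogeneousGroup n) (k : G.Horizontal) {i : Fin (n + 1)}
    (hi : G.weight i = 1) (x : E (n + 1)) : G.X k x i = (stdVec k.1 : E (n + 1)) i := by
  obtain ⟨p, hp, hpe⟩ := G.exists_polynomial_X k i
  have hp0 : p.vars = ∅ := by
    refine Finset.eq_empty_of_forall_notMem fun j hj => ?_
    have h1 := weight_le_of_mem_vars hp hj
    have h2 := G.weight_pos j
    omega
  rw [← G.X_zero k, hpe, hpe]
  refine MvPolynomial.eval₂Hom_congr' rfl ?_ rfl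
  intro j hj
  simp [hp0] at hj

end HomogeneousGroup

/-- A family of polynomials which are the components of the fields `X_k` in the higher strata. -/
def IsXCoeff {n : ℕ} (G : HomogeneousGroup n)
    (a : G.Horizontal → G.Vertical → MvPolynomial (Fin (n + 1)) ℝ) : Prop :=
  ∀ k x, G.X k x = stdVec k.1 +
    ∑ i : G.Vertical, MvPolynomial.eval (fun j => x j) (a k i) • stdVec i.1

theorem exists_isXCoeff {n : ℕ} (G : HomogeneousGroup n) :
    ∃ a : G.Horizontal → G.Vertical → MvPolynomial (Fin (n + 1)) ℝ,
      (∀ k i, (a k i).IsWeightedHomogeneous G.weight (G.weight i - 1) ∧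
        ∀ j ∈ (a k i).vars, G.weight j < G.weight i) ∧ IsXCoeff G a := by
  choose p hp hpe using G.exists_polynomial_X
  refine ⟨fun k i => p k i.1, fun k i => ⟨hp k i, fun j hj => ?_⟩, fun k x => ?_⟩
  · have h1 := weight_le_of_mem_vars (hp k i) hj
    have h2 := i.2
    omega
  · ext j
    simp only [PiLp.add_apply, WithLp.ofLp_sum, Finset.sum_apply, PiLp.smul_apply, stdVec_apply,
      smul_eq_mul, mul_ite, mul_one, mul_zero]
    by_cases hj : 2 ≤ G.weight j
    · rw [Finset.sum_eq_single (⟨j, hj⟩ : G.Vertical)]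
      · have hjk : j ≠ k.1 := by
          rintro rfl
          have := k.2
          omega
        simp [hpe, hjk]
      · intro b _ hb
        rw [if_neg]
        rintro rfl
        exact hb rfl
      · simp
    · rw [Finset.sum_eq_zero]
      · have := G.weight_pos j
        rw [G.X_apply_of_weight_eq_one k (by omega), stdVec_apply, add_zero]
      · intro b _
        rw [if_neg]
        rintro rfl
        exact hj b.2

/-! ### The coframe and the contraction of the volume form -/

theorem dx_apply {d : ℕ} (i : Fin d) (x : E d) : dx i x = x i := rfl

theorem volForm_apply {d : ℕ} (v : Fin d → E d) :
    volForm d v = Matrix.det (Matrix.of fun i j => v i j) := rfl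

theorem contractVol_apply {n : ℕ} (X : E (n + 1) → E (n + 1)) (x : E (n + 1))
    (v : Fin n → E (n + 1)) :
    contractVol X x v = volForm (n + 1) (Fin.cons (X x) v) := rfl

/-- The wedge product of `d` covectors on `ℝ^d` is a multiple of the volume form. -/
theorem wedge_eq_volForm_mul_det {d : ℕ} (η : Fin d → E d →ₗ[ℝ] ℝ) (v : Fin d → E d) :
    wedge η v = volForm d v * Matrix.det (Matrix.of fun i j => η j (stdVec i)) := by
  rw [wedge_apply, volForm_apply, ← Matrix.det_mul]
  congr 1
  ext i j
  rw [Matrix.mul_apply]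
  conv_lhs => rw [Matrix.of_apply, ← sum_smul_stdVec (v i)]
  simp

namespace CarnotGroup

variable {n : ℕ} (G : CarnotGroup n)
  (a : G.Horizontal → G.Vertical → MvPolynomial (Fin (n + 1)) ℝ)

theorem coframe_apply_of_weight_eq_one (x : E (n + 1)) {i : Fin (n + 1)} (hi : G.weight i = 1)
    (y : E (n + 1)) : G.coframe a x i y = y i := by
  have : ¬ 2 ≤ G.weight i := by omega
  simp [coframe, this, dx_apply]

theorem coframe_apply_vertical (x : E (n + 1)) (i : G.Vertical) (y : E (n + 1)) :
    G.coframe a x i.1 y =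
      -(∑ k : G.Horizontal, MvPolynomial.eval (fun j => x j) (a k i) * y k.1) + y i.1 := by
  simp [coframe, i.2, dx_apply]

/-- Weights are nondecreasing, so horizontal indices precede vertical ones. The corrections in θ_i
pair vertical covectors with horizontal vectors only, hence lie on one side of the diagonal whatever
`a` is. -/
theorem det_coframe (x : E (n + 1)) :
    Matrix.det (Matrix.of fun i j => G.coframe a x j (stdVec i)) = 1 := by
  have hw : ∀ i j, j < i → ¬ (G.weight i = 1 ∧ 2 ≤ G.weight j) := fun i j hij h => by
    have := G.weight_mono hij.le
    omega
  rw [Matrix.det_of_isUpperTriangular]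
  · refine Finset.prod_eq_one fun i _ => ?_
    rw [Matrix.of_apply]
    by_cases hi : 2 ≤ G.weight i
    · rw [G.coframe_apply_vertical a x ⟨i, hi⟩, Finset.sum_eq_zero]
      · simp [stdVec_apply]
      · intro k _
        have : k.1 ≠ i := by
          rintro rfl
          have := k.2
          omega
        simp [stdVec_apply, this]
    · have := G.weight_pos i
      rw [G.coframe_apply_of_weight_eq_one a x (by omega)]
      simp [stdVec_apply]
  · intro i j hij
    change j < i at hij
    rw [Matrix.of_apply]
    by_cases hj : 2 ≤ G.weight j
    · rw [G.coframe_apply_vertical a x ⟨j, hj⟩, Finset.sum_eq_zero]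
      · simp [stdVec_apply, hij.ne]
      · intro k _
        have : k.1 ≠ i := by
          rintro rfl
          exact hw _ _ hij ⟨k.2, hj⟩
        simp [stdVec_apply, this]
    · have := G.weight_pos j
      rw [G.coframe_apply_of_weight_eq_one a x (by omega)]
      simp [stdVec_apply, hij.ne]

variable {a}

/-- This is what θ_i is designed for: its correction -a_{k,i} dx_k cancels the component a_{k,i} of
X_k. -/
theorem coframe_X (ha : IsXCoeff G.toHomogeneousGroup a) (k : G.Horizontal) (x : E (n + 1))
    (i : Fin (n + 1)) : G.coframe a x i (G.X k x) = if i = k.1 then 1 else 0 := by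
  by_cases hi : 2 ≤ G.weight i
  · have hik : i ≠ k.1 := by
      rintro rfl
      have := k.2
      omega
    have hX : G.X k x i = MvPolynomial.eval (fun j => x j) (a k ⟨i, hi⟩) := by
      rw [ha k x]
      simp only [PiLp.add_apply, WithLp.ofLp_sum, Finset.sum_apply, PiLp.smul_apply, stdVec_apply,
        smul_eq_mul, mul_ite, mul_one, mul_zero, if_neg hik]
      rw [Finset.sum_eq_single (⟨i, hi⟩ : G.Vertical)]
      · simp
      · intro b _ hb
        rw [if_neg]
        rintro rfl
        exact hb rfl
      · simp
    rw [G.coframe_apply_vertical a x ⟨i, hi⟩, if_neg hik, Finset.sum_eq_single k]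
    · rw [G.X_apply_of_weight_eq_one k k.2, hX]
      simp [stdVec_apply]
    · intro l _ hl
      rw [G.X_apply_of_weight_eq_one k l.2, stdVec_apply, if_neg (fun h => hl (Subtype.ext h)),
        mul_zero]
    · simp
  · have := G.weight_pos i
    rw [G.coframe_apply_of_weight_eq_one a x (by omega),
      G.X_apply_of_weight_eq_one k (by omega), stdVec_apply]

/-- The coframe has determinant 1, so its full wedge is dν. In dν (X_k, v_1, …, v_n) the first row
consists of the values of the coframe on X_k, a unit vector, and the Laplace expansion along it has
one term. -/
theorem contractVol_X (ha : IsXCoeff G.toHomogeneousGroup a) (k : G.Horizontal)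
    (x : E (n + 1)) :
    contractVol (G.X k) x =
      (-1 : ℝ) ^ (k.1 : ℕ) • wedge (fun j : Fin n => G.coframe a x (k.1.succAbove j)) := by
  ext v
  have h := wedge_eq_volForm_mul_det (G.coframe a x) (Fin.cons (G.X k x) v)
  rw [det_coframe, mul_one] at h
  rw [contractVol_apply, ← h, wedge_apply, Matrix.det_succ_row_zero,
    Finset.sum_eq_single k.1]
  · simp only [Matrix.of_apply, Fin.cons_zero, G.coframe_X ha, if_true, mul_one,
      AlternatingMap.smul_apply, smul_eq_mul, wedge_apply]
    rfl
  · intro j _ hj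
    simp [G.coframe_X ha, hj]
  · simp

end CarnotGroup

/-! ### Weak divergence, and the vanishing divergence of the X_k -/

variable {V : Type*} [NormedAddCommGroup V] [NormedSpace ℝ V]

/-- The pairing of a covector with a vector with components in `V`. -/
def pairing {d : ℕ} (F : Fin d → V) (ξ : E d →L[ℝ] ℝ) : V := ∑ i, ξ (stdVec i) • F i

theorem pairing_add {d : ℕ} (F : Fin d → V) (ξ η : E d →L[ℝ] ℝ) :
    pairing F (ξ + η) = pairing F ξ + pairing F η := by
  simp [pairing, add_smul, Finset.sum_add_distrib]

theorem pairing_smul {d : ℕ} (F : Fin d → V) (c : ℝ) (ξ : E d →L[ℝ] ℝ) :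
    pairing F (c • ξ) = c • pairing F ξ := by
  simp [pairing, mul_smul, Finset.smul_sum]

theorem pairing_zero {d : ℕ} (F : Fin d → V) : pairing F (0 : E d →L[ℝ] ℝ) = 0 := by
  simp [pairing]

theorem norm_pairing_le {d : ℕ} (F : Fin d → V) (ξ : E d →L[ℝ] ℝ) :
    ‖pairing F ξ‖ ≤ ‖ξ‖ * ∑ i, ‖F i‖ := by
  rw [Finset.mul_sum]
  refine norm_sum_le_of_le _ fun i _ => ?_
  rw [norm_smul]
  gcongr
  exact (ξ.le_opNorm _).trans (by simp [stdVec])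

theorem ContinuousOn.pairing {d : ℕ} {T : Type*} [TopologicalSpace T] {s : Set T}
    {F : T → Fin d → V} {ξ : T → E d →L[ℝ] ℝ} (hF : ContinuousOn F s) (hξ : ContinuousOn ξ s) :
    ContinuousOn (fun t => pairing (F t) (ξ t)) s :=
  continuousOn_finsetSum _ fun i _ =>
    (hξ.clm_apply continuousOn_const).smul (continuousOn_pi.1 hF i)

theorem Continuous.pairing {d : ℕ} {T : Type*} [TopologicalSpace T]
    {F : T → Fin d → V} {ξ : T → E d →L[ℝ] ℝ} (hF : Continuous F) (hξ : Continuous ξ) :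
    Continuous (fun t => pairing (F t) (ξ t)) :=
  continuous_finsetSum _ fun i _ =>
    (hξ.clm_apply continuous_const).smul ((continuous_apply i).comp hF)

/-- `g` is the divergence, in the sense of distributions on `Ω`, of the vector field `F` with
components in `V`. -/
def IsWeakDiv {d : ℕ} (Ω : Set (E d)) (F : E d → Fin d → V) (g : E d → V) : Prop :=
  ∀ ζ : E d → ℝ, ContDiff ℝ 1 ζ → HasCompactSupport ζ → tsupport ζ ⊆ Ω →
    ∫ x in Ω, (ζ x • g x + pairing (F x) (fderiv ℝ ζ x)) = 0

/-- The vector field `∑ f_k Y_k`. -/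
def fieldOf {d : ℕ} {ι : Type*} [Fintype ι] (Y : ι → E d → E d) (f : ι → E d → V) (x : E d)
    (i : Fin d) : V :=
  ∑ k, Y k x i • f k x

/-- Applied with ξ = dζ to produce Y_k ζ, and with ξ a `fluxCovector` to produce ⟨Y_k, dν⟩. -/
theorem pairing_fieldOf {d : ℕ} {ι : Type*} [Fintype ι] (Y : ι → E d → E d) (f : ι → E d → V)
    (x : E d) (ξ : E d →L[ℝ] ℝ) : pairing (fieldOf Y f x) ξ = ∑ k, ξ (Y k x) • f k x := by
  simp only [pairing, fieldOf, Finset.smul_sum]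
  rw [Finset.sum_comm]
  refine Finset.sum_congr rfl fun k _ => ?_
  conv_rhs => rw [← sum_smul_stdVec (Y k x)]
  simp [Finset.sum_smul, smul_smul, mul_comm]

theorem continuous_fieldOf {d : ℕ} {ι : Type*} [Fintype ι] {Y : ι → E d → E d} {f : ι → E d → V}
    (hY : ∀ k, Continuous (Y k)) (hf : ∀ k, Continuous (f k)) : Continuous (fieldOf Y f) :=
  continuous_pi fun i => continuous_finsetSum _ fun k _ =>
    ((EuclideanSpace.proj (𝕜 := ℝ) i : E d →L[ℝ] ℝ).continuous.comp (hY k)).smul (hf k)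

/-- Integration by parts against the constant function 1. -/
theorem integral_fderiv_eq_zero {d : ℕ} {h : E d → V} (hh : ContDiff ℝ 1 h)
    (hc : HasCompactSupport h) (v : E d) : ∫ x, fderiv ℝ h x v = 0 := by
  have h1 : Integrable fun x => fderiv ℝ h x v :=
    ((hh.continuous_fderiv (by simp)).clm_apply continuous_const).integrable_of_hasCompactSupport
      (hc.fderiv_apply (𝕜 := ℝ) v)
  have := integral_smul_fderiv_eq_neg_fderiv_smul_of_integrable (𝕜 := ℝ) (μ := volume)
    (f := fun _ : E d => (1 : ℝ)) (g := h) (v := v) (by simp) (by simpa using h1)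
    (by simpa using hh.continuous.integrable_of_hasCompactSupport hc)
    (fun x _ => differentiableAt_const _) (fun x _ => hh.differentiable (by simp) x)
  simpa using this

/-- A coefficient constant along v passes under the derivative: a ∂_v h = ∂_v (a h). -/
theorem integral_smul_fderiv_eq_zero {d : ℕ} {a : E d → ℝ} (ha : ContDiff ℝ 1 a) {v : E d}
    (hav : ∀ x, fderiv ℝ a x v = 0) {h : E d → V} (hh : ContDiff ℝ 1 h)
    (hc : HasCompactSupport h) : ∫ x, a x • fderiv ℝ h x v = 0 := by
  have h1 : (fun x => a x • fderiv ℝ h x v) = fun x => fderiv ℝ (fun y => a y • h y) x v := by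
    ext x
    rw [fderiv_fun_smul (ha.differentiable (by simp) x) (hh.differentiable (by simp) x)]
    simp [hav]
  rw [h1]
  exact integral_fderiv_eq_zero (ha.smul hh) hc.smul_left v

theorem contDiff_eval {d : ℕ} (p : MvPolynomial (Fin d) ℝ) :
    ContDiff ℝ ∞ fun x : E d => MvPolynomial.eval (fun j => x j) p := by
  induction p using MvPolynomial.induction_on with
  | C r => simpa using contDiff_const
  | add p q hp hq => simpa using hp.add hq
  | mul_X p i hp =>
    simpa using hp.mul (EuclideanSpace.proj (𝕜 := ℝ) i : E d →L[ℝ] ℝ).contDiff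

theorem fderiv_eval_eq_zero {d : ℕ} {p : MvPolynomial (Fin d) ℝ} {i : Fin d} (hi : i ∉ p.vars)
    (x : E d) : fderiv ℝ (fun x : E d => MvPolynomial.eval (fun j => x j) p) x (stdVec i) = 0 := by
  rw [← ((contDiff_eval p).differentiable (by simp) x).lineDeriv_eq_fderiv, lineDeriv]
  have : (fun t : ℝ => MvPolynomial.eval (fun j => (x + t • stdVec i : E d) j) p) =
      fun _ => MvPolynomial.eval (fun j => x j) p := by
    ext t
    refine MvPolynomial.eval₂Hom_congr' rfl ?_ rfl
    intro j hj _
    have : j ≠ i := fun h => hi (h ▸ hj)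
    simp [stdVec_apply, this]
  rw [this]
  exact deriv_const _ _

/-- The fields `X_k` are divergence free. -/
theorem integral_fderiv_X_eq_zero {n : ℕ} (G : HomogeneousGroup n) (k : G.Horizontal)
    {h : E (n + 1) → V} (hh : ContDiff ℝ 1 h) (hc : HasCompactSupport h) :
    ∫ x, fderiv ℝ h x (G.X k x) = 0 := by
  obtain ⟨a, ha, haX⟩ := exists_isXCoeff G
  have hcont : ∀ v, Continuous fun x => fderiv ℝ h x v := fun v =>
    (hh.continuous_fderiv (by simp)).clm_apply continuous_const
  have hi : ∀ v, Integrable fun x => fderiv ℝ h x v := fun v =>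
    (hcont v).integrable_of_hasCompactSupport (hc.fderiv_apply (𝕜 := ℝ) v)
  have hs : ∀ i : G.Vertical, Integrable fun x : E (n + 1) =>
      MvPolynomial.eval (fun j => x j) (a k i) • fderiv ℝ h x (stdVec i.1) := fun i =>
    ((contDiff_eval (a k i)).continuous.smul (hcont _)).integrable_of_hasCompactSupport
      (hc.fderiv_apply (𝕜 := ℝ) _).smul_left
  have h1 : (fun x => fderiv ℝ h x (G.X k x)) = fun x => fderiv ℝ h x (stdVec k.1) +
      ∑ i : G.Vertical, MvPolynomial.eval (fun j => x j) (a k i) • fderiv ℝ h x (stdVec i.1) := by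
    ext x
    rw [haX k x]
    simp
  rw [h1, integral_add (hi _) (integrable_finsetSum _ fun i _ => hs i),
    integral_fderiv_eq_zero hh hc, zero_add, integral_finsetSum _ fun i _ => hs i]
  refine Finset.sum_eq_zero fun i _ => ?_
  -- Every variable of `a k i` has weight below that of x_i, so x_i is not among them.
  exact integral_smul_fderiv_eq_zero ((contDiff_eval _).of_le (by simp))
    (fun x => fderiv_eval_eq_zero (fun hv => lt_irrefl _ ((ha k i).2 _ hv)) x) hh hc

theorem contDiff_of_forall_mem_tsupport {X Z : Type*} [NormedAddCommGroup X] [NormedSpace ℝ X]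
    [NormedAddCommGroup Z] [NormedSpace ℝ Z] {m : WithTop ℕ∞} {f : X → Z}
    (h : ∀ x ∈ tsupport f, ContDiffAt ℝ m f x) : ContDiff ℝ m f := by
  refine contDiff_iff_contDiffAt.2 fun x => ?_
  by_cases hx : x ∈ tsupport f
  · exact h x hx
  · exact contDiffAt_const.congr_of_eventuallyEq (notMem_tsupport_iff_eventuallyEq.1 hx)

/-- For `f_k` of class `C^1` and divergence free fields `Y_k`, the divergence of `∑ f_k Y_k` is
`∑ Y_k f_k`. -/
theorem isWeakDiv_fieldOf {d : ℕ} {ι : Type*} [Fintype ι] {Y : ι → E d → E d}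
    (hY : ∀ k, Continuous (Y k))
    (hdiv : ∀ k (h : E d → V), ContDiff ℝ 1 h → HasCompactSupport h →
      ∫ x, fderiv ℝ h x (Y k x) = 0)
    {Ω : Set (E d)} (hΩ : IsOpen Ω) {f : ι → E d → V} (hf : ∀ k, ContDiffOn ℝ 1 (f k) Ω) :
    IsWeakDiv Ω (fieldOf Y f) fun x => ∑ k, fderiv ℝ (f k) x (Y k x) := by
  intro ζ hζ hc hs
  have hsub : ∀ k, tsupport (fun x => ζ x • f k x) ⊆ tsupport ζ := fun k =>
    tsupport_smul_subset_left ζ (f k)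
  -- Nothing is known of f_k outside Ω, but ζ f_k is C^1 everywhere because the support of ζ lies in
  -- Ω.
  have hh : ∀ k, ContDiff ℝ 1 fun x => ζ x • f k x := fun k =>
    contDiff_of_forall_mem_tsupport fun x hx => hζ.contDiffAt.smul
      ((hf k).contDiffAt (hΩ.mem_nhds (hs (hsub k hx))))
  have hhc : ∀ k, HasCompactSupport fun x => ζ x • f k x := fun k => hc.smul_right
  have hcont : ∀ k, Continuous fun x => fderiv ℝ (fun x => ζ x • f k x) x (Y k x) := fun k =>
    ((hh k).continuous_fderiv (by simp)).clm_apply (hY k)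
  have hz : ∀ k x, x ∉ tsupport ζ → fderiv ℝ (fun x => ζ x • f k x) x (Y k x) = 0 :=
    fun k x hx => by
      rw [fderiv_of_notMem_tsupport (𝕜 := ℝ) fun h => hx (hsub k h)]
      simp
  have hi : ∀ k, Integrable fun x => fderiv ℝ (fun x => ζ x • f k x) x (Y k x) := fun k =>
    (hcont k).integrable_of_hasCompactSupport (HasCompactSupport.intro hc (hz k))
  -- Leibniz: ζ Y_k f_k + (Y_k ζ) f_k = Y_k (ζ f_k), whose integral over the whole space vanishes.
  have h1 : Set.EqOn (fun x => ζ x • ∑ k, fderiv ℝ (f k) x (Y k x) +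
      pairing (fieldOf Y f x) (fderiv ℝ ζ x))
      (fun x => ∑ k, fderiv ℝ (fun x => ζ x • f k x) x (Y k x)) Ω := by
    intro x hx
    simp only [pairing_fieldOf, Finset.smul_sum, ← Finset.sum_add_distrib]
    refine Finset.sum_congr rfl fun k _ => ?_
    rw [fderiv_fun_smul (hζ.differentiable (by simp) x)
      (((hf k).contDiffAt (hΩ.mem_nhds hx)).differentiableAt (by simp))]
    simp
  rw [setIntegral_congr_fun hΩ.measurableSet h1,
    setIntegral_eq_integral_of_forall_compl_eq_zero, integral_finsetSum _ fun k _ => hi k]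
  · exact Finset.sum_eq_zero fun k _ => hdiv k _ (hh k) (hhc k)
  · intro x hx
    exact Finset.sum_eq_zero fun k _ => hz k x fun h => hx (hs h)

/-! ### Straightening a piece of the boundary -/

/-- The covector `y ↦ dν (y, v_1, …, v_n)`. -/
def fluxCovector {n : ℕ} (v : Fin n → E (n + 1)) : E (n + 1) →L[ℝ] ℝ :=
  LinearMap.toContinuousLinearMap
    { toFun := fun y => volForm (n + 1) (Fin.cons y v)
      map_add' := fun x y => (volForm (n + 1)).toMultilinearMap.cons_add v x y
      map_smul' := fun c x => (volForm (n + 1)).toMultilinearMap.cons_smul v c x }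

theorem fluxCovector_apply {n : ℕ} (v : Fin n → E (n + 1)) (y : E (n + 1)) :
    fluxCovector v y = volForm (n + 1) (Fin.cons y v) := rfl

theorem continuous_volForm (d : ℕ) : Continuous fun v : Fin d → E d => volForm d v := by
  simp only [volForm_apply]
  refine Continuous.matrix_det (continuous_pi fun i => continuous_pi fun j => ?_)
  exact (EuclideanSpace.proj (𝕜 := ℝ) j : E d →L[ℝ] ℝ).continuous.comp (continuous_apply i)

theorem continuous_fluxCovector {n : ℕ} :
    Continuous (fluxCovector : (Fin n → E (n + 1)) → E (n + 1) →L[ℝ] ℝ) := by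
  rw [continuous_clm_apply]
  intro y
  exact (continuous_volForm (n + 1)).comp (continuous_const.finCons continuous_id)

theorem fluxCovector_self {n : ℕ} (v : Fin n → E (n + 1)) (j : Fin n) :
    fluxCovector v (v j) = 0 :=
  (volForm (n + 1)).map_eq_zero_of_eq _ (i := 0) (j := j.succ) (by simp) (Fin.succ_ne_zero j).symm

/-- The last `n` coordinates of a point of `ℝ^{n+1}`. -/
def tail {n : ℕ} : E (n + 1) →L[ℝ] E n :=
  LinearMap.toContinuousLinearMap
    { toFun := fun y => WithLp.toLp 2 fun j => y j.succ
      map_add' := fun _ _ => rfl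
      map_smul' := fun _ _ => rfl }

theorem tail_apply {n : ℕ} (y : E (n + 1)) (j : Fin n) : tail y j = y j.succ := rfl

/-- The first coordinate of a point of `ℝ^{n+1}`. -/
def head {n : ℕ} : E (n + 1) →L[ℝ] ℝ := EuclideanSpace.proj 0

theorem head_apply {n : ℕ} (y : E (n + 1)) : head y = y 0 := rfl

/-- The point of `ℝ^{n+1}` with first coordinate `t` and last coordinates `u`. -/
def join {n : ℕ} (p : ℝ × E n) : E (n + 1) := WithLp.toLp 2 (Fin.cons p.1 fun j => p.2 j)

@[simp]
theorem head_join {n : ℕ} (p : ℝ × E n) : head (join p) = p.1 := rfl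

@[simp]
theorem tail_join {n : ℕ} (p : ℝ × E n) : tail (join p) = p.2 := rfl

@[simp]
theorem join_head_tail {n : ℕ} (y : E (n + 1)) : join (head y, tail y) = y := by
  ext j
  refine Fin.cases rfl (fun j => rfl) j

theorem continuous_join {n : ℕ} : Continuous (join : ℝ × E n → E (n + 1)) := by
  refine (PiLp.continuous_toLp 2 _).comp (continuous_pi fun i => ?_)
  refine Fin.cases continuous_fst (fun j => ?_) i
  exact (EuclideanSpace.proj (𝕜 := ℝ) j : E n →L[ℝ] ℝ).continuous.comp continuous_snd

theorem head_stdVec_zero {n : ℕ} : head (stdVec 0 : E (n + 1)) = 1 := by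
  simp [head_apply, stdVec_apply]

theorem tail_stdVec_zero {n : ℕ} : tail (stdVec 0 : E (n + 1)) = 0 := by
  ext j
  simp [tail_apply, stdVec_apply]

theorem head_stdVec_succ {n : ℕ} (j : Fin n) : head (stdVec j.succ : E (n + 1)) = 0 := by
  simp [head_apply, stdVec_apply, (Fin.succ_ne_zero j).symm]

theorem tail_stdVec_succ {n : ℕ} (j : Fin n) : tail (stdVec j.succ : E (n + 1)) = stdVec j := by
  ext i
  simp [tail_apply, stdVec_apply]

/-- The cylinder with base the ball of radius `r` around `u₀`. -/
def cylinder {n : ℕ} (u₀ : E n) (r : ℝ) : Set (E (n + 1)) :=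
  {y | |head y| < r ∧ tail y ∈ Metric.ball u₀ r}

theorem isOpen_cylinder {n : ℕ} (u₀ : E n) (r : ℝ) : IsOpen (cylinder u₀ r) :=
  (isOpen_lt (head.continuous.abs) continuous_const).inter (Metric.isOpen_ball.preimage tail.continuous)

theorem exists_cylinder_subset {n : ℕ} {u₀ : E n} {s : Set (E (n + 1))}
    (hs : s ∈ 𝓝 (join (0, u₀))) : ∃ r > 0, cylinder u₀ r ⊆ s := by
  obtain ⟨r, hr, h⟩ := Metric.mem_nhds_iff.1 (continuous_join.continuousAt hs)
  refine ⟨r, hr, fun y hy => ?_⟩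
  rw [← join_head_tail y]
  refine h ?_
  rw [Metric.mem_ball, Prod.dist_eq, max_lt_iff]
  exact ⟨by simpa using hy.1, hy.2⟩

theorem det_eq_volForm {d : ℕ} (L : E d →L[ℝ] E d) : L.det = volForm d fun i => L (stdVec i) := by
  rw [ContinuousLinearMap.det, ← LinearMap.det_toMatrix (EuclideanSpace.basisFun (Fin d) ℝ).toBasis,
    ← Matrix.det_transpose, volForm_apply]
  congr 1

/-- The partial derivatives of a map. -/
def tangent {n m : ℕ} (φ : E n → E m) (u : E n) (j : Fin n) : E m := fderiv ℝ φ u (stdVec j)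

/-- The map `(t, u) ↦ φ u + t w`. -/
def straighten {n : ℕ} (φ : E n → E (n + 1)) (w : E (n + 1)) (y : E (n + 1)) : E (n + 1) :=
  φ (tail y) + head y • w

/-- The derivative of `straighten`. -/
def straightenDeriv {n : ℕ} (φ : E n → E (n + 1)) (w : E (n + 1)) (y : E (n + 1)) :
    E (n + 1) →L[ℝ] E (n + 1) :=
  (fderiv ℝ φ (tail y)).comp tail + head.smulRight w

theorem hasFDerivAt_straighten {n : ℕ} {φ : E n → E (n + 1)} {w y : E (n + 1)}
    (hφ : DifferentiableAt ℝ φ (tail y)) :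
    HasFDerivAt (straighten φ w) (straightenDeriv φ w y) y :=
  (hφ.hasFDerivAt.comp y tail.hasFDerivAt).add (head.hasFDerivAt.smul_const w)

theorem contDiffAt_straighten {n : ℕ} {φ : E n → E (n + 1)} {w y : E (n + 1)} {m : WithTop ℕ∞}
    (hφ : ContDiffAt ℝ m φ (tail y)) : ContDiffAt ℝ m (straighten φ w) y :=
  (hφ.comp y tail.contDiff.contDiffAt).add (head.contDiff.contDiffAt.smul contDiffAt_const)

theorem straightenDeriv_stdVec_zero {n : ℕ} (φ : E n → E (n + 1)) (w y : E (n + 1)) :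
    straightenDeriv φ w y (stdVec 0) = w := by
  simp [straightenDeriv, head_stdVec_zero, tail_stdVec_zero]

theorem straightenDeriv_stdVec_succ {n : ℕ} (φ : E n → E (n + 1)) (w y : E (n + 1)) (j : Fin n) :
    straightenDeriv φ w y (stdVec j.succ) = tangent φ (tail y) j := by
  simp [straightenDeriv, head_stdVec_succ, tail_stdVec_succ, tangent]

/-- The standard basis is sent to w, ∂_1 φ, …, ∂_n φ. For w = ∇ρ, positivity of this Jacobian at the
base point is the orientation condition. -/
theorem det_straightenDeriv {n : ℕ} (φ : E n → E (n + 1)) (w y : E (n + 1)) :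
    (straightenDeriv φ w y).det = fluxCovector (tangent φ (tail y)) w := by
  rw [det_eq_volForm, fluxCovector_apply]
  congr 1
  ext1 i
  refine Fin.cases ?_ (fun j => ?_) i
  · simp [straightenDeriv_stdVec_zero]
  · simp [straightenDeriv_stdVec_succ]

/-- In the coordinates `(t, u)`, the flux covector is the Jacobian determinant times `dt`. -/
theorem fluxCovector_comp_straightenDeriv {n : ℕ} (φ : E n → E (n + 1)) (w y : E (n + 1)) :
    (fluxCovector (tangent φ (tail y))).comp (straightenDeriv φ w y) =
      (fluxCovector (tangent φ (tail y)) w) • head := by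
  ext v
  rw [← sum_smul_stdVec v]
  simp only [map_sum, map_smul]
  refine Finset.sum_congr rfl fun i _ => ?_
  congr 1
  refine Fin.cases ?_ (fun j => ?_) i
  · simp [straightenDeriv_stdVec_zero, head_stdVec_zero]
  · simp [straightenDeriv_stdVec_succ, fluxCovector_self, head_stdVec_succ]

/-- Coordinates in which a piece of the boundary of `Ω` parametrised by `φ` is straight. -/
structure BoundaryChart {n : ℕ} (Ω : Set (E (n + 1))) (φ : E n → E (n + 1)) (u₀ : E n) where
  w : E (n + 1)
  r : ℝ
  r_pos : 0 < r
  e : OpenPartialHomeomorph (E (n + 1)) (E (n + 1))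
  source_eq : e.source = cylinder u₀ r
  coe_eq : ⇑e = straighten φ w
  contDiffAt : ∀ u ∈ Metric.ball u₀ r, ContDiffAt ℝ 1 φ u
  contDiffAt_symm : ∀ x ∈ e.target, ContDiffAt ℝ 1 e.symm x
  jacobian_pos : ∀ u ∈ Metric.ball u₀ r, 0 < fluxCovector (tangent φ u) w
  mem_iff : ∀ y ∈ cylinder u₀ r, straighten φ w y ∈ Ω ↔ head y < 0

theorem straighten_join_zero {n : ℕ} (φ : E n → E (n + 1)) (w : E (n + 1)) (u : E n) :
    straighten φ w (join (0, u)) = φ u := by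
  simp [straighten]

theorem continuousAt_tangent {n m : ℕ} {φ : E n → E m} {u : E n} (hφ : ContDiffAt ℝ 1 φ u) :
    ContinuousAt (tangent φ) u := by
  have : ContinuousAt (fderiv ℝ φ) u := (hφ.fderiv_right (m := 0) (by simp)).continuousAt
  exact continuousAt_pi.2 fun j => this.clm_apply continuousAt_const

/-- Where ρ > 0 there are no points of Ω nearby, and where ρ < 0 the point lies in the open set Ω; a
frontier point allows neither. -/
theorem eq_zero_of_mem_frontier_of_eq_sublevel {d : ℕ} {Ω V : Set (E d)} {ρ : E d → ℝ}
    (hΩ : IsOpen Ω) (hV : IsOpen V) (hρ : ContinuousOn ρ V) (h : Ω ∩ V = {y | ρ y < 0} ∩ V)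
    {x : E d} (hx : x ∈ frontier Ω) (hxV : x ∈ V) : ρ x = 0 := by
  refine le_antisymm ?_ ?_
  · by_contra! hpos
    have h1 : ∀ᶠ y in 𝓝 x, 0 < ρ y ∧ y ∈ V :=
      ((hρ.continuousAt (hV.mem_nhds hxV)).eventually (lt_mem_nhds hpos)).and (hV.mem_nhds hxV)
    obtain ⟨y, ⟨hy, hyV⟩, hyΩ⟩ := mem_closure_iff_nhds.1 (frontier_subset_closure hx) _ h1
    have : y ∈ {y | ρ y < 0} ∩ V := h ▸ ⟨hyΩ, hyV⟩
    exact lt_asymm hy this.1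
  · by_contra! hneg
    have : x ∈ Ω ∩ V := h.symm ▸ ⟨hneg, hxV⟩
    rw [hΩ.frontier_eq] at hx
    exact hx.2 this.1

/-- Take w = ∇ρ at the base point. The orientation condition makes the Jacobian nonzero, so the
inverse function theorem applies. Along each line t ↦ φ(u) + t w the function ρ is strictly
increasing, and it vanishes at t = 0 because φ(u) is a frontier point; hence Ω is t < 0. -/
theorem exists_boundaryChart {n : ℕ} {Ω V : Set (E (n + 1))} {ρ : E (n + 1) → ℝ}
    {φ : E n → E (n + 1)} {u₀ : E n} (hΩ : IsOpen Ω) (hV : IsOpen V) (hρ : ContDiffOn ℝ 1 ρ V)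
    (h : Ω ∩ V = {y | ρ y < 0} ∩ V) (huV : φ u₀ ∈ V) (hφ : ContDiffAt ℝ 1 φ u₀)
    (hor : 0 < fluxCovector (tangent φ u₀) (gradient ρ (φ u₀)))
    {D : Set (E n)} (hD : D ∈ 𝓝 u₀) (hfr : ∀ u ∈ D, φ u ∈ frontier Ω) :
    ∃ c : BoundaryChart Ω φ u₀, Metric.ball u₀ c.r ⊆ D := by
  set w := gradient ρ (φ u₀) with hw
  set y₀ : E (n + 1) := join (0, u₀) with hy₀
  have hty : tail y₀ = u₀ := rfl
  have hΦy : straighten φ w y₀ = φ u₀ := straighten_join_zero φ w u₀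
  have hΦ : ContDiffAt ℝ 1 (straighten φ w) y₀ := contDiffAt_straighten hφ
  have hdet : (straightenDeriv φ w y₀).det ≠ 0 := by
    rw [det_straightenDeriv]
    exact hor.ne'
  have hΦ' : HasFDerivAt (straighten φ w)
      ((straightenDeriv φ w y₀).toContinuousLinearEquivOfDetNeZero hdet :
        E (n + 1) →L[ℝ] E (n + 1)) y₀ := by
    rw [ContinuousLinearMap.coe_toContinuousLinearEquivOfDetNeZero]
    exact hasFDerivAt_straighten (hφ.differentiableAt (by simp))
  let e := hΦ.toOpenPartialHomeomorph (straighten φ w) hΦ' (by simp)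
  have he : ⇑e = straighten φ w := rfl
  -- Six conditions stable near the base point; a single cylinder on which all of them hold becomes
  -- the domain of the chart.
  have c1 : ∀ᶠ y in 𝓝 y₀, y ∈ e.source :=
    e.open_source.mem_nhds (hΦ.mem_toOpenPartialHomeomorph_source hΦ' (by simp))
  have c2 : ∀ᶠ y in 𝓝 y₀, ContDiffAt ℝ 1 e.symm (straighten φ w y) :=
    hΦ.continuousAt.eventually ((hΦ.to_localInverse hΦ' (by simp)).eventually (by simp))
  have htail : Tendsto tail (𝓝 y₀) (𝓝 u₀) := tail.continuous.tendsto y₀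
  have c3 : ∀ᶠ y in 𝓝 y₀, ContDiffAt ℝ 1 φ (tail y) :=
    htail.eventually (hφ.eventually (by simp))
  have c4 : ∀ᶠ y in 𝓝 y₀, 0 < fluxCovector (tangent φ (tail y)) w := by
    refine htail.eventually (ContinuousAt.eventually_lt (f := fun _ => (0 : ℝ))
      (g := fun u => fluxCovector (tangent φ u) w) continuousAt_const ?_ hor)
    exact (continuous_fluxCovector.continuousAt.comp (continuousAt_tangent hφ)).clm_apply
      continuousAt_const
  have c5 : ∀ᶠ y in 𝓝 y₀, tail y ∈ D := htail.eventually hD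
  have c6 : ∀ᶠ y in 𝓝 y₀, straighten φ w y ∈ V ∧ 0 < fderiv ℝ ρ (straighten φ w y) w := by
    suffices hx : ∀ᶠ x in 𝓝 (straighten φ w y₀), x ∈ V ∧ 0 < fderiv ℝ ρ x w from
      hΦ.continuousAt.eventually hx
    rw [hΦy]
    refine Filter.Eventually.and (hV.mem_nhds huV) ?_
    have hc : ContinuousAt (fderiv ℝ ρ) (φ u₀) :=
      ((hρ.contDiffAt (hV.mem_nhds huV)).fderiv_right (m := 0) (by simp)).continuousAt
    refine ContinuousAt.eventually_lt (f := fun _ => (0 : ℝ))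
      (g := fun x => fderiv ℝ ρ x w) continuousAt_const (hc.clm_apply continuousAt_const) ?_
    have hw0 : w ≠ 0 := by
      rintro h0
      rw [h0, map_zero] at hor
      exact lt_irrefl _ hor
    have hd : DifferentiableAt ℝ ρ (φ u₀) :=
      (hρ.contDiffAt (hV.mem_nhds huV)).differentiableAt (by simp)
    have : inner ℝ (gradient ρ (φ u₀)) w = fderiv ℝ ρ (φ u₀) w := inner_gradient_left ..
    rw [← this, ← hw]
    exact real_inner_self_pos.2 hw0
  obtain ⟨r, hr, hcyl⟩ := exists_cylinder_subset
    (c1.and (c2.and (c3.and (c4.and (c5.and c6)))))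
  have hmemj : ∀ {t : ℝ} {u : E n}, |t| < r → u ∈ Metric.ball u₀ r →
      join (t, u) ∈ cylinder u₀ r := fun ht hu => ⟨ht, hu⟩
  have hball : ∀ {u}, u ∈ Metric.ball u₀ r → join (0, u) ∈ cylinder u₀ r := fun hu =>
    hmemj (by simpa using hr) hu
  have hsrc : cylinder u₀ r ⊆ e.source := fun y hy => (hcyl hy).1
  let e' := e.restrOpen (cylinder u₀ r) (isOpen_cylinder u₀ r)
  have he's : e'.source = cylinder u₀ r := by
    simp only [e', OpenPartialHomeomorph.restrOpen_source]
    exact Set.inter_eq_right.2 hsrc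
  refine ⟨⟨w, r, hr, e', he's, he, fun u hu => (hcyl (hball hu)).2.2.1, ?_,
    fun u hu => (hcyl (hball hu)).2.2.2.1, ?_⟩, fun u hu => (hcyl (hball hu)).2.2.2.2.1⟩
  · intro x hx
    have hx' := e'.map_target hx
    rw [he's] at hx'
    have := (hcyl hx').2.1
    have hxx : straighten φ w (e'.symm x) = x := e'.right_inv hx
    rwa [hxx] at this
  · intro y hy
    obtain ⟨t, u, rfl⟩ : ∃ t u, y = join (t, u) := ⟨head y, tail y, (join_head_tail y).symm⟩
    have ht : |t| < r := hy.1
    have hu : u ∈ Metric.ball u₀ r := hy.2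
    have hline : ∀ s, straighten φ w (join (s, u)) = φ u + s • w := fun s => by
      simp [straighten]
    have hderiv : ∀ s ∈ Set.Ioo (-r) r,
        HasDerivAt (fun s => ρ (φ u + s • w)) (fderiv ℝ ρ (φ u + s • w) w) s := by
      intro s hs
      have h6 := (hcyl (hmemj (abs_lt.2 hs) hu)).2.2.2.2.2
      rw [hline] at h6
      have hd : DifferentiableAt ℝ ρ (φ u + s • w) :=
        (hρ.contDiffAt (hV.mem_nhds h6.1)).differentiableAt (by simp)
      have h1 : HasDerivAt (fun s : ℝ => φ u + s • w) w s := by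
        simpa using ((hasDerivAt_id s).smul_const w).const_add (φ u)
      exact hd.hasFDerivAt.comp_hasDerivAt s h1
    have hmono : StrictMonoOn (fun s => ρ (φ u + s • w)) (Set.Ioo (-r) r) := by
      refine strictMonoOn_of_deriv_pos (convex_Ioo _ _)
        (fun s hs => (hderiv s hs).continuousAt.continuousWithinAt) fun s hs => ?_
      rw [interior_Ioo] at hs
      rw [(hderiv s hs).deriv, ← hline]
      exact (hcyl (hmemj (abs_lt.2 hs) hu)).2.2.2.2.2.2
    have h0 : ρ (φ u + (0 : ℝ) • w) = 0 := by
      have h5 := (hcyl (hball hu)).2.2.2.2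
      rw [straighten_join_zero] at h5
      simpa using eq_zero_of_mem_frontier_of_eq_sublevel hΩ hV hρ.continuousOn h
        (hfr u h5.1) h5.2.1
    have hV' := (hcyl hy).2.2.2.2.2.1
    have hiff : straighten φ w (join (t, u)) ∈ Ω ↔ ρ (straighten φ w (join (t, u))) < 0 := by
      have := Set.ext_iff.1 h (straighten φ w (join (t, u)))
      simpa [hV'] using this
    have hlt := hmono.lt_iff_lt (abs_lt.1 ht) ⟨neg_lt_zero.2 hr, hr⟩
    simp only [h0] at hlt
    rw [hiff, hline, head_join]
    exact hlt

/-! ### Peak functions concentrated on a hyperplane -/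

theorem measurePreserving_join (n : ℕ) :
    MeasurePreserving (join : ℝ × E n → E (n + 1)) volume volume := by
  have h1 : MeasurePreserving (Prod.map id (WithLp.ofLp : E n → Fin n → ℝ))
      (volume : Measure (ℝ × E n)) volume :=
    (MeasurePreserving.id volume).prod (PiLp.volume_preserving_ofLp (Fin n))
  have h2 := (volume_preserving_piFinSuccAbove (fun _ : Fin (n + 1) => ℝ) 0).symm
  have h3 := (PiLp.volume_preserving_toLp (Fin (n + 1))).comp (h2.comp h1)
  have hj : (join : ℝ × E n → E (n + 1)) = WithLp.toLp 2 ∘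
      ⇑(MeasurableEquiv.piFinSuccAbove (fun _ => ℝ) 0).symm ∘ Prod.map id WithLp.ofLp := by
    ext p i
    refine Fin.cases ?_ (fun j => ?_) i <;> rfl
  rw [hj]
  exact h3

theorem measurableEmbedding_join (n : ℕ) :
    MeasurableEmbedding (join : ℝ × E n → E (n + 1)) :=
  (Homeomorph.mk (Equiv.mk join (fun y => (head y, tail y)) (fun _ => rfl) join_head_tail)
    continuous_join (head.continuous.prodMk tail.continuous)).measurableEmbedding

theorem integral_join {n : ℕ} (f : E (n + 1) → V) : ∫ p, f (join p) = ∫ y, f y :=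
  (measurePreserving_join n).integral_comp (measurableEmbedding_join n) f

/-- A smooth function on the line which is `1` on `(-∞, -2]` and `0` on `[-1, ∞)`. -/
def stepDown (s : ℝ) : ℝ := Real.smoothTransition (-s - 1)

theorem contDiff_stepDown : ContDiff ℝ ∞ stepDown :=
  Real.smoothTransition.contDiff.comp (contDiff_neg.sub contDiff_const)

theorem stepDown_eq_one {s : ℝ} (hs : s ≤ -2) : stepDown s = 1 :=
  Real.smoothTransition.one_of_one_le (by linarith)

theorem stepDown_eq_zero {s : ℝ} (hs : -1 ≤ s) : stepDown s = 0 :=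
  Real.smoothTransition.zero_of_nonpos (by linarith)

theorem stepDown_nonneg (s : ℝ) : 0 ≤ stepDown s := Real.smoothTransition.nonneg _

theorem stepDown_le_one (s : ℝ) : stepDown s ≤ 1 := Real.smoothTransition.le_one _

/-- The bump function `-stepDown'`. -/
def stepKernel (s : ℝ) : ℝ := -deriv stepDown s

theorem hasDerivAt_stepDown (s : ℝ) : HasDerivAt stepDown (-stepKernel s) s := by
  rw [stepKernel, neg_neg]
  exact (contDiff_stepDown.differentiable (by simp) s).hasDerivAt

theorem continuous_stepKernel : Continuous stepKernel :=
  (contDiff_stepDown.continuous_deriv (by simp)).neg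

theorem stepKernel_nonneg (s : ℝ) : 0 ≤ stepKernel s := by
  have : Monotone fun s => -stepDown s := fun a b hab => by
    simp only [stepDown, neg_le_neg_iff]
    exact Real.smoothTransition.monotone (by linarith)
  have h := this.deriv_nonneg (x := s)
  rwa [deriv.fun_neg] at h

theorem stepKernel_eq_zero_of_ge {s : ℝ} (hs : -1 ≤ s) : stepKernel s = 0 := by
  have h : IsMinOn stepDown Set.univ s := fun t _ => by
    simpa [stepDown_eq_zero hs] using stepDown_nonneg t
  rw [stepKernel, (h.isLocalMin univ_mem).deriv_eq_zero, neg_zero]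

theorem stepKernel_eq_zero_of_le {s : ℝ} (hs : s ≤ -2) : stepKernel s = 0 := by
  have h : IsMaxOn stepDown Set.univ s := fun t _ => by
    simpa [stepDown_eq_one hs] using stepDown_le_one t
  rw [stepKernel, (h.isLocalMax univ_mem).deriv_eq_zero, neg_zero]

theorem hasCompactSupport_stepKernel : HasCompactSupport stepKernel :=
  HasCompactSupport.intro (K := Set.Icc (-2) (-1)) isCompact_Icc fun s hs => by
    by_cases h : -2 ≤ s
    · exact stepKernel_eq_zero_of_ge (not_lt.1 fun h' => hs ⟨h, h'.le⟩)
    · exact stepKernel_eq_zero_of_le (not_le.1 h).le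

theorem integral_stepKernel : ∫ s, stepKernel s = 1 := by
  have h := integral_of_hasDerivAt_of_tendsto (f := stepDown) (f' := fun s => -stepKernel s)
    (m := 1) (n := 0) hasDerivAt_stepDown
    (continuous_stepKernel.integrable_of_hasCompactSupport hasCompactSupport_stepKernel).neg
    (tendsto_const_nhds.congr' (by
      filter_upwards [Iic_mem_atBot (-2 : ℝ)] with s hs using (stepDown_eq_one hs).symm))
    (tendsto_const_nhds.congr' (by
      filter_upwards [Ici_mem_atTop (-1 : ℝ)] with s hs using (stepDown_eq_zero hs).symm))
  rw [integral_neg] at h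
  linarith

/-- Integrals against kernels concentrated on the hyperplane `t = 0` converge to the integral over
this hyperplane. -/
theorem tendsto_integral_stepKernel_smul [CompleteSpace V] {n : ℕ} {Q : E (n + 1) → V}
    (hQ : Continuous Q) (hc : HasCompactSupport Q) :
    Tendsto (fun c : ℝ => ∫ y, (c * stepKernel (c * head y)) • Q y) atTop
      (𝓝 (∫ u, Q (join (0, u)))) := by
  let q : ℝ → V := fun t => ∫ u, Q (join (t, u))
  have hQj : Continuous fun p : ℝ × E n => Q (join p) := hQ.comp continuous_join
  have hK : IsCompact (tail '' tsupport Q) := hc.image tail.continuous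
  have hjc : HasCompactSupport fun p : ℝ × E n => Q (join p) := by
    refine HasCompactSupport.intro (hc.image (head.continuous.prodMk tail.continuous)) fun p hp => ?_
    exact image_eq_zero_of_notMem_tsupport fun h => hp ⟨_, h, rfl⟩
  have hqc : Continuous q := by
    rw [← continuousOn_univ]
    refine continuousOn_integral_of_compact_support hK hQj.continuousOn fun t u _ hu => ?_
    exact image_eq_zero_of_notMem_tsupport fun h => hu ⟨_, h, rfl⟩
  have hqi : Integrable q :=
    (hQj.integrable_of_hasCompactSupport hjc).integral_prod_left
  -- The rescaled kernels form an approximate identity on the line, tested against the slice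
  -- integrals q. Their support lies on one side of 0, which is harmless since q is continuous
  -- there.
  have h := tendsto_integral_comp_smul_smul_of_integrable (μ := (volume : Measure ℝ))
    stepKernel_nonneg integral_stepKernel (tendsto_const_nhds.congr' (by
      have : Bornology.IsBounded (tsupport stepKernel) := hasCompactSupport_stepKernel.isCompact.isBounded
      filter_upwards [Bornology.isCobounded_def.1 (Bornology.IsBounded.compl this)] with s hs
      rw [show stepKernel s = 0 from image_eq_zero_of_notMem_tsupport hs, mul_zero])) hqi hqc.continuousAt
  refine h.congr fun c => ?_
  rw [← integral_join, Measure.volume_eq_prod, integral_prod]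
  · refine integral_congr_ae (ae_of_all _ fun t => ?_)
    simp [q, integral_smul]
  · refine Continuous.integrable_of_hasCompactSupport ?_ hjc.smul_left
    exact (continuous_const.mul (continuous_stepKernel.comp (continuous_const.mul
      (head.continuous.comp continuous_join)))).smul hQj

/-- Serves to extend by zero expressions that are under control only inside a chart. -/
theorem continuous_of_continuousOn_of_eq_zero {X W : Type*} [TopologicalSpace X]
    [TopologicalSpace W] [Zero W] {f : X → W}
    {U K : Set X} (hU : IsOpen U) (hK : IsClosed K) (hKU : K ⊆ U) (hf : ContinuousOn f U)
    (h0 : ∀ x ∉ K, f x = 0) : Continuous f := by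
  refine continuous_iff_continuousAt.2 fun x => ?_
  by_cases hx : x ∈ K
  · exact hf.continuousAt (hU.mem_nhds (hKU hx))
  · refine continuousAt_const.congr (f := fun _ => (0 : W)) ?_
    filter_upwards [hK.isOpen_compl.mem_nhds hx] with y hy using (h0 y hy).symm

/-! ### The divergence formula near a regular boundary point -/

namespace BoundaryChart

variable {n : ℕ} {Ω : Set (E (n + 1))} {φ : E n → E (n + 1)} {u₀ : E n}

/-- The coordinate transverse to the boundary. -/
def height (c : BoundaryChart Ω φ u₀) (x : E (n + 1)) : ℝ := head (c.e.symm x)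

variable (c : BoundaryChart Ω φ u₀)

theorem contDiffAt_height {x : E (n + 1)} (hx : x ∈ c.e.target) : ContDiffAt ℝ 1 c.height x :=
  head.contDiff.contDiffAt.comp x (c.contDiffAt_symm x hx)

theorem continuousOn_height : ContinuousOn c.height c.e.target := fun _ hx =>
  (c.contDiffAt_height hx).continuousAt.continuousWithinAt

theorem height_apply {y : E (n + 1)} (hy : y ∈ c.e.source) : c.height (c.e y) = head y := by
  rw [height, c.e.left_inv hy]

theorem symm_mem {x : E (n + 1)} (hx : x ∈ c.e.target) : c.e.symm x ∈ cylinder u₀ c.r :=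
  c.source_eq ▸ c.e.map_target hx

theorem mem_iff_height {x : E (n + 1)} (hx : x ∈ c.e.target) : x ∈ Ω ↔ c.height x < 0 := by
  have h := c.mem_iff _ (c.symm_mem hx)
  rwa [← c.coe_eq, c.e.right_inv hx] at h

theorem hasFDerivAt {y : E (n + 1)} (hy : y ∈ c.e.source) :
    HasFDerivAt c.e (straightenDeriv φ c.w y) y := by
  rw [c.coe_eq]
  refine hasFDerivAt_straighten ((c.contDiffAt _ ?_).differentiableAt (by simp))
  rw [c.source_eq] at hy
  exact hy.2

/-- Both covectors agree after composition with the derivative of the chart, in which `height` is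
the coordinate t, and that derivative is surjective. The identity converts a volume integral of
d(height) into a flux. -/
theorem jacobian_smul_fderiv_height {y : E (n + 1)} (hy : y ∈ c.e.source) :
    fluxCovector (tangent φ (tail y)) c.w • fderiv ℝ c.height (c.e y) =
      fluxCovector (tangent φ (tail y)) := by
  set L := straightenDeriv φ c.w y with hL
  have hJ : 0 < fluxCovector (tangent φ (tail y)) c.w :=
    c.jacobian_pos _ ((c.source_eq ▸ hy : y ∈ cylinder u₀ c.r)).2
  have hdet : L.det ≠ 0 := by
    rw [hL, det_straightenDeriv]
    exact hJ.ne'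
  have h1 : (fderiv ℝ c.height (c.e y)).comp L = head := by
    have hd : DifferentiableAt ℝ c.height (c.e y) :=
      (c.contDiffAt_height (c.e.map_source hy)).differentiableAt (by simp)
    have h2 := hd.hasFDerivAt.comp y (c.hasFDerivAt hy)
    refine h2.unique (head.hasFDerivAt.congr_of_eventuallyEq ?_)
    filter_upwards [c.e.open_source.mem_nhds hy] with z hz using c.height_apply hz
  ext v
  obtain ⟨z, rfl⟩ : ∃ z, L z = v := (L.toContinuousLinearEquivOfDetNeZero hdet).surjective v
  have h3 := congrArg (fun T => T z) (fluxCovector_comp_straightenDeriv φ c.w y)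
  have h4 := congrArg (fun T => T z) h1
  simp only [ContinuousLinearMap.comp_apply, smul_apply] at h3 h4 ⊢
  rw [h4, hL, h3]

/-- The divergence formula for test functions supported in a chart. -/
theorem integral_eq [CompleteSpace V] {F : E (n + 1) → Fin (n + 1) → V} {g : E (n + 1) → V}
    (hΩ : IsOpen Ω) (hF : Continuous F) (hg : IntegrableOn g Ω) (hdiv : IsWeakDiv Ω F g)
    {ψ : E (n + 1) → ℝ} (hψ : ContDiff ℝ 1 ψ) (hψc : HasCompactSupport ψ)
    (hψs : tsupport ψ ⊆ c.e.target) :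
    ∫ x in Ω, (ψ x • g x + pairing (F x) (fderiv ℝ ψ x)) =
      ∫ u in Metric.ball u₀ c.r,
        ψ (φ u) • pairing (F (φ u)) (fluxCovector (tangent φ u)) := by
  have hT := c.e.open_target
  have hψ0 : ∀ x ∉ tsupport ψ, ψ x = 0 := fun x hx => image_eq_zero_of_notMem_tsupport hx
  have hdψ0 : ∀ x ∉ tsupport ψ, fderiv ℝ ψ x = 0 := fun x hx =>
    fderiv_of_notMem_tsupport (𝕜 := ℝ) hx
  have hdψ : Continuous (fderiv ℝ ψ) := hψ.continuous_fderiv (by simp)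
  let G : E (n + 1) → V := fun x => ψ x • g x + pairing (F x) (fderiv ℝ ψ x)
  have hG0 : ∀ x ∉ tsupport ψ, G x = 0 := fun x hx => by
    simp [G, hψ0 x hx, hdψ0 x hx, pairing_zero]
  have hGi : IntegrableOn G Ω := by
    refine Integrable.add ?_ (Continuous.integrable_of_hasCompactSupport ?_ ?_).integrableOn
    · obtain ⟨C, hC⟩ := hψc.exists_bound_of_continuous hψ.continuous
      exact hg.bdd_smul C hψ.continuous.aestronglyMeasurable (ae_of_all _ hC)
    · exact Continuous.pairing hF hdψ
    · exact HasCompactSupport.intro hψc fun x hx => by rw [hdψ0 x hx, pairing_zero]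
  let A : Set (E (n + 1)) := Ω ∩ c.e.target
  have hA : IsOpen A := hΩ.inter hT
  -- the boundary layer
  let H : ℝ → E (n + 1) → V := fun s x =>
    (s * stepKernel (s * c.height x)) • ψ x • pairing (F x) (fderiv ℝ c.height x)
  have hH0 : ∀ s, ∀ x ∉ tsupport ψ, H s x = 0 := fun s x hx => by simp [H, hψ0 x hx]
  have hHc : ∀ s, Continuous (H s) := fun s => by
    refine continuous_of_continuousOn_of_eq_zero hT hψc.isClosed hψs ?_ (hH0 s)
    have hd : ContinuousOn (fderiv ℝ c.height) c.e.target := fun x hx =>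
      ((c.contDiffAt_height hx).fderiv_right (m := 0) (by simp)).continuousAt.continuousWithinAt
    exact (continuousOn_const.mul (continuous_stepKernel.comp_continuousOn
      (continuousOn_const.mul c.continuousOn_height))).smul
      (hψ.continuous.continuousOn.smul (ContinuousOn.pairing hF.continuousOn hd))
  have hHi : ∀ s, Integrable (H s) := fun s =>
    (hHc s).integrable_of_hasCompactSupport (HasCompactSupport.intro hψc (hH0 s))
  have hGAi : ∀ s, IntegrableOn (fun x => stepDown (s * c.height x) • G x) A := fun s => by
    refine (hGi.mono_set Set.inter_subset_left).bdd_smul 1 ?_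
      (ae_of_all _ fun x => ?_)
    · exact (contDiff_stepDown.continuous.comp_continuousOn (continuousOn_const.mul
        (c.continuousOn_height.mono Set.inter_subset_right))).aestronglyMeasurable
          hA.measurableSet
    · rw [Real.norm_of_nonneg (stepDown_nonneg _)]
      exact stepDown_le_one _
  -- The weak divergence is tested with ζ, the product of ψ and a step in the height; H is the
  -- contribution of the derivative of the step.
  have hcut : ∀ s : ℝ, 0 < s →
      ∫ x in A, stepDown (s * c.height x) • G x = ∫ x in c.e.target, H s x := by
    intro s hs
    let ζ : E (n + 1) → ℝ := fun x => stepDown (s * c.height x) * ψ x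
    have hζs : tsupport ζ ⊆ tsupport ψ := tsupport_mul_subset_right
    have hζd : ∀ x ∈ c.e.target, HasFDerivAt ζ (stepDown (s * c.height x) • fderiv ℝ ψ x +
        ψ x • (-stepKernel (s * c.height x)) • s • fderiv ℝ c.height x) x := fun x hx => by
      have h1 : HasFDerivAt c.height (fderiv ℝ c.height x) x :=
        ((c.contDiffAt_height hx).differentiableAt (by simp)).hasFDerivAt
      exact ((hasDerivAt_stepDown _).comp_hasFDerivAt x (h1.const_mul s)).mul
        (hψ.differentiable (by simp) x).hasFDerivAt
    have hζ : ContDiff ℝ 1 ζ := contDiff_of_forall_mem_tsupport fun x hx => by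
      refine ContDiffAt.mul ?_ hψ.contDiffAt
      exact (contDiff_stepDown.of_le (by simp)).contDiffAt.comp x
        (contDiffAt_const.mul (c.contDiffAt_height (hψs (hζs hx))))
    -- The step vanishes already where s * height ≥ -1, strictly before the boundary, so the closed
    -- support of ζ stays inside Ω.
    have hsub : tsupport ζ ⊆ Ω := by
      have hC : IsClosed (tsupport ψ ∩ c.height ⁻¹' Set.Iic (-1 / s)) :=
        (c.continuousOn_height.mono hψs).preimage_isClosed_of_isClosed hψc.isClosed isClosed_Iic
      have h1 : tsupport ζ ⊆ tsupport ψ ∩ c.height ⁻¹' Set.Iic (-1 / s) := by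
        refine closure_minimal (fun x hx => ⟨hζs (subset_closure hx), ?_⟩) hC
        by_contra h
        rw [Set.mem_preimage, Set.mem_Iic, not_le, div_lt_iff₀ hs] at h
        refine hx ?_
        simp only [ζ]
        rw [stepDown_eq_zero (by linarith), zero_mul]
      intro x hx
      obtain ⟨hx1, hx2⟩ := h1 hx
      refine (c.mem_iff_height (hψs hx1)).2 (lt_of_le_of_lt hx2 ?_)
      exact div_neg_of_neg_of_pos (by norm_num) hs
    have hζ0 : ∀ x ∉ tsupport ψ, ζ x • g x + pairing (F x) (fderiv ℝ ζ x) = 0 := fun x hx => by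
      rw [fderiv_of_notMem_tsupport (𝕜 := ℝ) fun h => hx (hζs h), pairing_zero]
      simp [ζ, hψ0 x hx]
    have h1 := hdiv ζ hζ (hψc.mono' (subset_tsupport _ |>.trans hζs)) hsub
    rw [setIntegral_eq_of_subset_of_forall_sdiff_eq_zero (s := A) hΩ.measurableSet
      Set.inter_subset_left fun x hx => hζ0 x fun h => hx.2 ⟨hx.1, hψs h⟩] at h1
    have h2 : Set.EqOn (fun x => ζ x • g x + pairing (F x) (fderiv ℝ ζ x))
        (fun x => stepDown (s * c.height x) • G x - H s x) A := fun x hx => by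
      simp only [(hζd x hx.2).fderiv, ζ, G, H, pairing_add, pairing_smul, smul_add, smul_smul]
      module
    rw [setIntegral_congr_fun hA.measurableSet h2,
      integral_sub (hGAi s) (hHi s).integrableOn, sub_eq_zero] at h1
    -- Off Ω the height is nonnegative and the kernel vanishes, so H may be integrated over the
    -- whole chart.
    rw [h1, setIntegral_eq_of_subset_of_forall_sdiff_eq_zero (s := A) hT.measurableSet
      Set.inter_subset_right]
    intro x hx
    have hx' : 0 ≤ c.height x := not_lt.1 fun h => hx.2 ⟨(c.mem_iff_height hx.1).2 h, hx.1⟩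
    have : -1 ≤ s * c.height x := by nlinarith
    simp [H, stepKernel_eq_zero_of_ge this]
  -- the interior term
  have hlim1 : Tendsto (fun s : ℝ => ∫ x in A, stepDown (s * c.height x) • G x) atTop
      (𝓝 (∫ x in Ω, G x)) := by
    rw [setIntegral_eq_of_subset_of_forall_sdiff_eq_zero (s := A) hΩ.measurableSet
      Set.inter_subset_left fun x hx => hG0 x fun h => hx.2 ⟨hx.1, hψs h⟩]
    refine tendsto_integral_filter_of_dominated_convergence (fun x => ‖G x‖)
      (Eventually.of_forall fun s => (hGAi s).aestronglyMeasurable)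
      (Eventually.of_forall fun s => ae_of_all _ fun x => ?_)
      (hGi.mono_set Set.inter_subset_left).norm
      ((ae_restrict_iff' hA.measurableSet).2 (ae_of_all _ fun x hx => ?_))
    · rw [norm_smul, Real.norm_of_nonneg (stepDown_nonneg _)]
      exact mul_le_of_le_one_left (norm_nonneg _) (stepDown_le_one _)
    · have hneg : c.height x < 0 := (c.mem_iff_height hx.2).1 hx.1
      refine tendsto_const_nhds.congr' ?_
      have : Tendsto (fun s : ℝ => s * c.height x) atTop atBot :=
        tendsto_id.atTop_mul_const_of_neg hneg
      filter_upwards [this.eventually (Iic_mem_atBot (-2))] with s hs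
      rw [stepDown_eq_one hs, one_smul]
  -- the boundary term
  let Q : E (n + 1) → V := (cylinder u₀ c.r).indicator fun y =>
    ψ (c.e y) • pairing (F (c.e y)) (fluxCovector (tangent φ (tail y)))
  have hcylo := isOpen_cylinder u₀ c.r
  have hK : IsCompact (c.e.symm '' tsupport ψ) :=
    hψc.isCompact.image_of_continuousOn (c.e.continuousOn_symm.mono hψs)
  have hKs : c.e.symm '' tsupport ψ ⊆ cylinder u₀ c.r := by
    rintro _ ⟨x, hx, rfl⟩
    exact c.symm_mem (hψs hx)
  have hQ0 : ∀ y ∉ c.e.symm '' tsupport ψ, Q y = 0 := by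
    intro y hy
    by_cases hyc : y ∈ cylinder u₀ c.r
    · have : c.e y ∉ tsupport ψ := fun h =>
        hy ⟨_, h, c.e.left_inv (c.source_eq.symm ▸ hyc)⟩
      simp [Q, Set.indicator_of_mem hyc, hψ0 _ this]
    · exact Set.indicator_of_notMem hyc _
  have hQ : Continuous Q := by
    refine continuous_of_continuousOn_of_eq_zero hcylo hK.isClosed hKs ?_ hQ0
    refine ContinuousOn.congr ?_ (fun y hy => Set.indicator_of_mem hy _)
    have he : ContinuousOn c.e (cylinder u₀ c.r) := c.source_eq ▸ c.e.continuousOn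
    refine (hψ.continuous.comp_continuousOn he).smul
      (ContinuousOn.pairing (hF.comp_continuousOn he) ?_)
    refine continuous_fluxCovector.comp_continuousOn fun y hy => ?_
    exact ((continuousAt_tangent (c.contDiffAt _ hy.2)).comp
      tail.continuous.continuousAt).continuousWithinAt
  -- In the coordinates (t, u) the Jacobian and d(height) combine into the flux covector, and s
  -- enters only through the kernel in t.
  have hchange : ∀ s : ℝ, ∫ x in c.e.target, H s x =
      ∫ y, (s * stepKernel (s * head y)) • Q y := by
    intro s
    rw [← c.e.image_source_eq_target, integral_image_eq_integral_abs_det_fderiv_smul volume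
      c.e.open_source.measurableSet (fun y hy => (c.hasFDerivAt hy).hasFDerivWithinAt) c.e.injOn,
      c.source_eq, ← integral_indicator hcylo.measurableSet]
    refine integral_congr_ae (ae_of_all _ fun y => ?_)
    by_cases hy : y ∈ cylinder u₀ c.r
    · have hys : y ∈ c.e.source := c.source_eq.symm ▸ hy
      have hJ := c.jacobian_pos _ hy.2
      simp only [Q, Set.indicator_of_mem hy, H, c.height_apply hys]
      rw [det_straightenDeriv, abs_of_pos hJ, smul_comm, smul_comm _ (ψ _), ← pairing_smul,
        c.jacobian_smul_fderiv_height hys]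
    · simp [Q, Set.indicator_of_notMem hy]
  have hlim2 := tendsto_integral_stepKernel_smul hQ (HasCompactSupport.intro hK hQ0)
  have hlim3 := hlim2.congr' (f₂ := fun s : ℝ => ∫ x in A, stepDown (s * c.height x) • G x) (by
    filter_upwards [Ioi_mem_atTop (0 : ℝ)] with s hs
    rw [hcut s hs, hchange])
  rw [tendsto_nhds_unique hlim1 hlim3, ← integral_indicator Metric.isOpen_ball.measurableSet]
  refine integral_congr_ae (ae_of_all _ fun u => ?_)
  by_cases hu : u ∈ Metric.ball u₀ c.r
  · have hj : join (0, u) ∈ cylinder u₀ c.r := ⟨by simpa using c.r_pos, hu⟩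
    simp only [Q, Set.indicator_of_mem hj, Set.indicator_of_mem hu, c.coe_eq,
      straighten_join_zero, tail_join]
  · have hj : join (0, u) ∉ cylinder u₀ c.r := fun h => hu h.2
    simp only [Q, Set.indicator_of_notMem hj, Set.indicator_of_notMem hu]

end BoundaryChart

/-! ### Cutting off the edges -/

/-- A set near which one can cut off by functions supported near `S₀` whose gradients have
arbitrarily small integrals. -/
def HasSmallCutoffs {d : ℕ} (S₀ S : Set (E d)) : Prop :=
  ∀ ε > 0, ∃ b : E d → ℝ, ContDiff ℝ 1 b ∧ HasCompactSupport b ∧ (∀ x, 0 ≤ b x) ∧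
    (∃ U, IsOpen U ∧ S ⊆ U ∧ ∀ x ∈ U, 1 ≤ b x) ∧ (∀ x, b x ≠ 0 → x ∈ Metric.thickening ε S₀) ∧
    ∫ x, ‖fderiv ℝ b x‖ ≤ ε

theorem integrable_norm_fderiv {d : ℕ} {b : E d → ℝ} (hb : ContDiff ℝ 1 b)
    (hc : HasCompactSupport b) : Integrable fun x => ‖fderiv ℝ b x‖ :=
  ((hb.continuous_fderiv (by simp)).integrable_of_hasCompactSupport (hc.fderiv (𝕜 := ℝ))).norm

/-- Cutoffs can be added, because b is required to be at least 1 near the set but not at most 1. The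
+1 in the denominator covers an empty index type. -/
theorem HasSmallCutoffs.iUnion {d : ℕ} {S₀ : Set (E d)} {ι : Type*} [Fintype ι] {S : ι → Set (E d)}
    (h : ∀ i, HasSmallCutoffs S₀ (S i)) : HasSmallCutoffs S₀ (⋃ i, S i) := by
  intro ε hε
  have hpos : (0 : ℝ) < Fintype.card ι + 1 := by positivity
  have hδ : 0 < ε / (Fintype.card ι + 1) := by positivity
  choose b hb hbc hb0 hbU hbS hbi using fun i => h i _ hδ
  choose U hU hSU hbU using hbU
  have hle : ε / (Fintype.card ι + 1) ≤ ε := div_le_self hε.le (by simp)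
  refine ⟨fun x => ∑ i, b i x, ContDiff.sum fun i _ => hb i, ?_,
    fun x => Finset.sum_nonneg fun i _ => hb0 i x, ⟨⋃ i, U i, isOpen_iUnion hU,
      Set.iUnion_mono hSU, fun x hx => ?_⟩, fun x hx => ?_, ?_⟩
  · refine HasCompactSupport.intro (isCompact_iUnion fun i => (hbc i).isCompact) fun x hx => ?_
    exact Finset.sum_eq_zero fun i _ =>
      image_eq_zero_of_notMem_tsupport fun h => hx (Set.mem_iUnion_of_mem i h)
  · obtain ⟨i, hi⟩ := Set.mem_iUnion.1 hx
    exact (hbU i x hi).trans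
      (Finset.single_le_sum (f := fun i => b i x) (fun j _ => hb0 j x) (Finset.mem_univ i))
  · obtain ⟨i, -, hi⟩ := Finset.exists_ne_zero_of_sum_ne_zero hx
    exact Metric.thickening_mono hle _ (hbS i x hi)
  · have h1 : ∀ x, ‖fderiv ℝ (fun x => ∑ i, b i x) x‖ ≤ ∑ i, ‖fderiv ℝ (b i) x‖ := fun x => by
      rw [fderiv_fun_sum fun i _ => (hb i).differentiable (by simp) x]
      exact norm_sum_le _ _
    calc ∫ x, ‖fderiv ℝ (fun x => ∑ i, b i x) x‖ ≤ ∫ x, ∑ i, ‖fderiv ℝ (b i) x‖ := by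
          refine integral_mono_of_nonneg (ae_of_all _ fun x => norm_nonneg _)
            (integrable_finsetSum _ fun i _ => integrable_norm_fderiv (hb i) (hbc i))
            (ae_of_all _ h1)
      _ = ∑ i, ∫ x, ‖fderiv ℝ (b i) x‖ :=
          integral_finsetSum _ fun i _ => integrable_norm_fderiv (hb i) (hbc i)
      _ ≤ ∑ _i : ι, ε / (Fintype.card ι + 1) := Finset.sum_le_sum fun i _ => hbi i
      _ = Fintype.card ι * (ε / (Fintype.card ι + 1)) := by simp
      _ ≤ ε := by
          rw [mul_div_assoc', div_le_iff₀ hpos]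
          nlinarith

/-- A compact set is covered by balls of radius `5 r` whose number is controlled by the volume of
its `r`-neighbourhood. -/
theorem exists_finset_cover_volume {n : ℕ} {K : Set (E n)} (hK : IsCompact K) {r : ℝ} (hr : 0 < r) :
    ∃ t : Finset (E n), ↑t ⊆ K ∧ (∀ y ∈ K, ∃ x ∈ t, dist y x ≤ 5 * r) ∧
      t.card * r ^ n * volume.real (Metric.ball (0 : E n) 1) ≤
        volume.real (Metric.cthickening r K) := by
  obtain ⟨s, hsK, hs, hcov⟩ := hK.finite_cover_balls hr
  -- Vitali: disjoint balls are selected from the finite cover so that their fivefold enlargements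
  -- still cover. Disjointness lets the volumes be added inside the neighbourhood of K.
  obtain ⟨u, hus, hdisj, hu⟩ := Vitali.exists_disjoint_subfamily_covering_enlargement_closedBall
    s (fun x : E n => x) (fun _ => r) r (fun _ _ => le_rfl) 5 (by norm_num)
  have hfin : u.Finite := hs.subset hus
  refine ⟨hfin.toFinset, by simpa using hus.trans hsK, fun y hy => ?_, ?_⟩
  · obtain ⟨a, ha, hya⟩ := Set.mem_iUnion₂.1 (hcov hy)
    obtain ⟨b, hb, hab⟩ := hu a ha
    exact ⟨b, by simpa using hb, hab (Metric.ball_subset_closedBall hya)⟩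
  · have hsub : (⋃ x ∈ hfin.toFinset, Metric.closedBall x r) ⊆ Metric.cthickening r K := by
      refine Set.iUnion₂_subset fun x hx => ?_
      exact Metric.closedBall_subset_cthickening (hsK (hus (by simpa using hx))) r
    have hne : volume (Metric.cthickening r K) ≠ ⊤ := hK.isBounded.cthickening.measure_lt_top.ne
    refine le_trans (le_of_eq ?_) (measureReal_mono hsub hne)
    rw [measureReal_biUnion_finset (by simpa using hdisj)
      (fun x _ => Metric.isClosed_closedBall.measurableSet)
      (fun x _ => (isCompact_closedBall x r).measure_ne_top)]
    have hv : ∀ x : E n, volume.real (Metric.closedBall x r) =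
        r ^ n * volume.real (Metric.ball (0 : E n) 1) := fun x => by
      rw [Measure.real, Measure.addHaar_closedBall _ _ hr.le, ENNReal.toReal_mul,
        ENNReal.toReal_ofReal (by positivity), finrank_euclideanSpace_fin, Measure.real]
    simp [hv, mul_assoc]

/-- In ℝ^{d+1} the gradient contributes R⁻¹ and the change of variables R^{d+1}. The resulting R^d
matches the volume of a parameter ball in ℝ^d. -/
theorem integral_norm_fderiv_rescale {d : ℕ} {η : E (d + 1) → ℝ} (hη : ContDiff ℝ 1 η)
    {R : ℝ} (hR : 0 < R) (p : E (d + 1)) :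
    ∫ x, ‖fderiv ℝ (fun x => η (R⁻¹ • (x - p))) x‖ = R ^ d * ∫ x, ‖fderiv ℝ η x‖ := by
  have h1 : ∀ x, ‖fderiv ℝ (fun x => η (R⁻¹ • (x - p))) x‖ =
      R⁻¹ * ‖fderiv ℝ η (R⁻¹ • (x - p))‖ := fun x => by
    have h2 : HasFDerivAt (fun x : E (d + 1) => R⁻¹ • (x - p))
        (R⁻¹ • ContinuousLinearMap.id ℝ (E (d + 1))) x :=
      ((hasFDerivAt_id x).sub_const p).fun_const_smul _
    have h3 := (hη.differentiable (by simp) (R⁻¹ • (x - p))).hasFDerivAt.comp x h2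
    have h4 : fderiv ℝ (fun x => η (R⁻¹ • (x - p))) x =
        R⁻¹ • fderiv ℝ η (R⁻¹ • (x - p)) := by
      refine (HasFDerivAt.fderiv h3).trans ?_
      ext v
      simp
    rw [h4, norm_smul, Real.norm_of_nonneg (by positivity)]
  simp only [h1]
  rw [integral_const_mul, integral_sub_right_eq_self (fun x => ‖fderiv ℝ η (R⁻¹ • x)‖) p,
    Measure.integral_comp_inv_smul_of_nonneg volume (fun x => ‖fderiv ℝ η x‖) hR.le,
    finrank_euclideanSpace_fin, smul_eq_mul, pow_succ]
  field_simp

/-- The image of a compact null set of `ℝ^n` under a Lipschitz map to `ℝ^{n+1}` has small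
cutoffs. -/
theorem hasSmallCutoffs_image {n : ℕ} {K : Set (E n)} (hK : IsCompact K) (hK0 : volume K = 0)
    {φ : E n → E (n + 1)} {L : NNReal} (hφ : LipschitzOnWith L φ K) {S₀ : Set (E (n + 1))}
    (hS₀ : φ '' K ⊆ S₀) : HasSmallCutoffs S₀ (φ '' K) := by
  intro ε hε
  let η : ContDiffBump (0 : E (n + 1)) := ⟨1, 2, one_pos, one_lt_two⟩
  have hη : ContDiff ℝ 1 η := η.contDiff
  set C := ∫ x, ‖fderiv ℝ η x‖ with hC
  set κ := volume.real (Metric.ball (0 : E n) 1) with hκ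
  have hκpos : 0 < κ :=
    ENNReal.toReal_pos (Metric.measure_ball_pos volume _ one_pos).ne' measure_ball_lt_top.ne
  have hC0 : 0 ≤ C := integral_nonneg fun _ => norm_nonneg _
  -- Points of K within 5 r of a centre have images within 5 L r of its image, strictly less than R
  -- = M r. Using L + 1 keeps M positive when L = 0.
  set M : ℝ := 5 * (L + 1) with hM
  have hMpos : 0 < M := by positivity
  -- This quantity will bound the integral of the gradient: the number of balls times R^n C. It
  -- tends to 0 because K is compact and null.
  have hlim : Tendsto (fun r => volume.real (Metric.cthickening r K) * (M ^ n * C / κ))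
      (𝓝[>] 0) (𝓝 0) := by
    have h1 := (tendsto_measure_cthickening_of_isCompact (μ := volume) hK).mono_left
      (nhdsWithin_le_nhds (s := Set.Ioi 0))
    rw [hK0] at h1
    have h2 := (ENNReal.tendsto_toReal ENNReal.zero_ne_top).comp h1
    simpa [Measure.real] using h2.mul_const (M ^ n * C / κ)
  have hsmall : ∀ᶠ r in 𝓝[>] (0 : ℝ), 2 * (M * r) < ε := by
    have : Tendsto (fun r : ℝ => 2 * (M * r)) (𝓝[>] 0) (𝓝 (2 * (M * 0))) :=
      Tendsto.mono_left (by fun_prop : Continuous fun r : ℝ => 2 * (M * r)).continuousAt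
        nhdsWithin_le_nhds
    refine this.eventually (gt_mem_nhds (by simpa using hε))
  obtain ⟨r, ⟨hrlim, hrs⟩, hr⟩ :=
    (((hlim.eventually (gt_mem_nhds hε)).and hsmall).and self_mem_nhdsWithin).exists
  have hr : 0 < r := hr
  obtain ⟨t, htK, hcov, hcard⟩ := exists_finset_cover_volume hK hr
  set R := M * r with hR
  have hRpos : 0 < R := by positivity
  let b : E n → E (n + 1) → ℝ := fun p x => η (R⁻¹ • (x - φ p))
  have hb : ∀ p, ContDiff ℝ 1 (b p) := fun p =>
    hη.comp (by fun_prop)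
  have hb0 : ∀ p x, b p x ≠ 0 → dist x (φ p) < 2 * R := fun p x hx => by
    have h1 : R⁻¹ • (x - φ p) ∈ Function.support η := hx
    rw [η.support_eq, Metric.mem_ball, dist_zero_right, norm_smul, norm_inv,
      Real.norm_of_nonneg hRpos.le, inv_mul_lt_iff₀ hRpos, ← dist_eq_norm] at h1
    linarith
  have hbc : ∀ p, HasCompactSupport (b p) := fun p =>
    HasCompactSupport.intro (isCompact_closedBall (φ p) (2 * R)) fun x hx => by
      by_contra h
      exact hx (hb0 p x h).le
  have hb1 : ∀ p, ∀ x ∈ Metric.ball (φ p) R, b p x = 1 := fun p x hx => by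
    refine η.one_of_mem_closedBall ?_
    rw [mem_closedBall_zero_iff, norm_smul, norm_inv, Real.norm_of_nonneg hRpos.le,
      inv_mul_le_iff₀ hRpos, ← dist_eq_norm]
    simpa [show η.rIn = 1 from rfl] using (Metric.mem_ball.1 hx).le
  refine ⟨fun x => ∑ p ∈ t, b p x, ContDiff.sum fun i _ => hb i, ?_,
    fun x => Finset.sum_nonneg fun i _ => η.nonneg, ⟨⋃ p ∈ t, Metric.ball (φ p) R,
      isOpen_biUnion fun _ _ => Metric.isOpen_ball, ?_, fun x hx => ?_⟩, fun x hx => ?_, ?_⟩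
  · refine HasCompactSupport.intro (t.isCompact_biUnion fun i _ => (hbc i).isCompact)
      fun x hx => ?_
    exact Finset.sum_eq_zero fun i hi =>
      image_eq_zero_of_notMem_tsupport fun h => hx (Set.mem_biUnion hi h)
  · rintro _ ⟨y, hy, rfl⟩
    obtain ⟨p, hp, hd⟩ := hcov y hy
    refine Set.mem_biUnion hp ?_
    have h1 := hφ.dist_le_mul y hy p (htK hp)
    have h2 : (L : ℝ) * dist y p ≤ L * (5 * r) := by gcongr
    rw [Metric.mem_ball]
    have : (0 : ℝ) ≤ L := L.2
    calc dist (φ y) (φ p) ≤ L * (5 * r) := h1.trans h2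
      _ < R := by rw [hR, hM]; nlinarith
  · obtain ⟨p, hp, hx⟩ := Set.mem_iUnion₂.1 hx
    exact (hb1 p x hx).symm.le.trans
      (Finset.single_le_sum (f := fun p => b p x) (fun j _ => η.nonneg) hp)
  · obtain ⟨p, hp, hx⟩ := Finset.exists_ne_zero_of_sum_ne_zero hx
    exact Metric.mem_thickening_iff.2
      ⟨φ p, hS₀ ⟨p, htK hp, rfl⟩, (hb0 p x hx).trans hrs⟩
  · have h1 : ∀ x, ‖fderiv ℝ (fun x => ∑ p ∈ t, b p x) x‖ ≤ ∑ p ∈ t, ‖fderiv ℝ (b p) x‖ :=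
      fun x => by
        rw [fderiv_fun_sum fun i _ => (hb i).differentiable (by simp) x]
        exact norm_sum_le _ _
    calc ∫ x, ‖fderiv ℝ (fun x => ∑ p ∈ t, b p x) x‖ ≤ ∫ x, ∑ p ∈ t, ‖fderiv ℝ (b p) x‖ := by
          refine integral_mono_of_nonneg (ae_of_all _ fun x => norm_nonneg _)
            (integrable_finsetSum _ fun i _ => integrable_norm_fderiv (hb i) (hbc i))
            (ae_of_all _ h1)
      _ = ∑ p ∈ t, ∫ x, ‖fderiv ℝ (b p) x‖ :=
          integral_finsetSum _ fun i _ => integrable_norm_fderiv (hb i) (hbc i)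
      _ = ∑ _p ∈ t, R ^ n * C :=
          Finset.sum_congr rfl fun p _ => integral_norm_fderiv_rescale hη hRpos (φ p)
      _ = (t.card * r ^ n * κ) * (M ^ n * C / κ) := by
          rw [Finset.sum_const, nsmul_eq_mul, hR, mul_pow]
          field_simp
      _ ≤ volume.real (Metric.cthickening r K) * (M ^ n * C / κ) := by gcongr
      _ ≤ ε := hrlim.le

theorem exists_lipschitzOnWith_of_contDiffAt {X Y : Type*} [NormedAddCommGroup X]
    [NormedSpace ℝ X] [NormedAddCommGroup Y] [NormedSpace ℝ Y] {φ : X → Y} {K : Set X}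
    (hK : IsCompact K) (hφ : ∀ u ∈ K, ContDiffAt ℝ 1 φ u) : ∃ L, LipschitzOnWith L φ K := by
  refine LocallyLipschitzOn.exists_lipschitzOnWith_of_compact hK fun u hu => ?_
  obtain ⟨L, t, ht, h⟩ := (hφ u hu).exists_lipschitzOnWith
  exact ⟨L, t, nhdsWithin_le_nhds ht, h⟩

theorem integrableOn_smul_test {d : ℕ} {Ω : Set (E d)} {g : E d → V} (hg : IntegrableOn g Ω)
    {ψ : E d → ℝ} (hψ : Continuous ψ) (hψc : HasCompactSupport ψ) :
    IntegrableOn (fun x => ψ x • g x) Ω := by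
  obtain ⟨C, hC⟩ := hψc.exists_bound_of_continuous hψ
  exact hg.bdd_smul C hψ.aestronglyMeasurable (ae_of_all _ hC)

theorem integrable_pairing_fderiv {d : ℕ} {F : E d → Fin d → V} (hF : Continuous F) {ψ : E d → ℝ}
    (hψ : ContDiff ℝ 1 ψ) (hψc : HasCompactSupport ψ) :
    Integrable fun x => pairing (F x) (fderiv ℝ ψ x) := by
  refine (Continuous.pairing hF (hψ.continuous_fderiv (by simp))).integrable_of_hasCompactSupport
    (HasCompactSupport.intro (hψc.fderiv (𝕜 := ℝ)) fun x hx => ?_)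
  rw [image_eq_zero_of_notMem_tsupport hx, pairing_zero]

theorem pairing_sum {d : ℕ} {ι : Type*} (s : Finset ι) (F : Fin d → V) (ξ : ι → E d →L[ℝ] ℝ) :
    pairing F (∑ k ∈ s, ξ k) = ∑ k ∈ s, pairing F (ξ k) := by
  classical
  induction s using Finset.induction_on with
  | empty => simp [pairing_zero]
  | insert k s hk ih => rw [Finset.sum_insert hk, Finset.sum_insert hk, pairing_add, ih]

/-! ### From the local formula to the divergence theorem on an admissible domain -/

namespace AdmissibleDomain

variable {n : ℕ} (D : AdmissibleDomain n)

/-- The union of the edges of the pieces of the boundary. -/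
def edges : Set (E (n + 1)) := ⋃ i, D.param i '' frontier (D.dom i)

/-- The coefficient of the flux of a vector field through a piece of the boundary. -/
def flux (F : E (n + 1) → Fin (n + 1) → V) (i : Fin D.pieces) (u : E n) : V :=
  pairing (F (D.param i u)) (fluxCovector (tangent (D.param i) u))

variable {D}

theorem contDiffAt {i : Fin D.pieces} {u : E n} (hu : u ∈ D.dom i) :
    ContDiffAt ℝ 1 (D.param i) u := (D.contDiffAt_param i u hu).of_le (by simp)

theorem continuousOn_param (i : Fin D.pieces) : ContinuousOn (D.param i) (D.dom i) := fun _ hu =>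
  (contDiffAt hu).continuousAt.continuousWithinAt

theorem frontier_dom_subset (i : Fin D.pieces) : frontier (D.dom i) ⊆ D.dom i :=
  (D.isCompact_dom i).isClosed.frontier_subset

theorem isCompact_frontier_dom (i : Fin D.pieces) : IsCompact (frontier (D.dom i)) :=
  (D.isCompact_dom i).of_isClosed_subset isClosed_frontier (frontier_dom_subset i)

theorem isCompact_edges : IsCompact D.edges := isCompact_iUnion fun i =>
  (isCompact_frontier_dom i).image_of_continuousOn
    ((continuousOn_param i).mono (frontier_dom_subset i))

theorem param_mem_frontier {i : Fin D.pieces} {u : E n} (hu : u ∈ D.dom i) :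
    D.param i u ∈ frontier D.carrier := by
  rw [D.frontier_eq]
  exact Set.mem_iUnion_of_mem i ⟨u, hu, rfl⟩

theorem param_notMem_carrier {i : Fin D.pieces} {u : E n} (hu : u ∈ D.dom i) :
    D.param i u ∉ D.carrier := by
  have := param_mem_frontier hu
  rw [D.isOpen.frontier_eq] at this
  exact this.2

theorem edges_subset_frontier : D.edges ⊆ frontier D.carrier := by
  refine Set.iUnion_subset fun i => ?_
  rintro _ ⟨u, hu, rfl⟩
  exact param_mem_frontier (frontier_dom_subset i hu)

theorem isCompact_closure_carrier : IsCompact (closure D.carrier) := D.isBounded.isCompact_closure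

theorem continuousOn_flux {F : E (n + 1) → Fin (n + 1) → V}
    (hF : ContinuousOn F (closure D.carrier)) (i : Fin D.pieces) :
    ContinuousOn (D.flux F i) (D.dom i) := by
  refine ContinuousOn.pairing (hF.comp (continuousOn_param i) fun u hu =>
    frontier_subset_closure (param_mem_frontier hu))
    (continuous_fluxCovector.comp_continuousOn fun u hu => ?_)
  exact (continuousAt_tangent (contDiffAt hu)).continuousWithinAt

theorem mem_interior_of_param_notMem_edges {i : Fin D.pieces} {u : E n} (hu : u ∈ D.dom i)
    (h : D.param i u ∉ D.edges) : u ∈ interior (D.dom i) := by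
  by_contra hi
  exact h (Set.mem_iUnion_of_mem i ⟨u, ⟨subset_closure hu, hi⟩, rfl⟩)

theorem exists_chart {i : Fin D.pieces} {u₀ : E n} (hu : u₀ ∈ interior (D.dom i)) :
    ∃ c : BoundaryChart D.carrier (D.param i) u₀, Metric.ball u₀ c.r ⊆ interior (D.dom i) := by
  obtain ⟨W, ρ, hW, huW, hρ, hΩ, hor⟩ := D.oriented i u₀ hu
  exact exists_boundaryChart D.isOpen hW (hρ.of_le (by simp)) hΩ huW
    (contDiffAt (interior_subset hu)) hor (isOpen_interior.mem_nhds hu)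
    fun u hu => param_mem_frontier (interior_subset hu)

theorem _root_.Carnot.BoundaryChart.param_mem_target {Ω : Set (E (n + 1))} {φ : E n → E (n + 1)}
    {u₀ : E n} (c : BoundaryChart Ω φ u₀) {u : E n} (hu : u ∈ Metric.ball u₀ c.r) :
    φ u ∈ c.e.target ∧ tail (c.e.symm (φ u)) = u := by
  have hj : join (0, u) ∈ c.e.source := by
    rw [c.source_eq]
    exact ⟨by simpa using c.r_pos, hu⟩
  have he : c.e (join (0, u)) = φ u := by rw [c.coe_eq, straighten_join_zero]
  rw [← he]
  exact ⟨c.e.map_source hj, by rw [c.e.left_inv hj, tail_join]⟩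

/-- Almost no parameter is mapped to an edge. -/
theorem ae_param_notMem_edges (i : Fin D.pieces) :
    ∀ᵐ u ∂volume.restrict (D.dom i), D.param i u ∉ D.edges := by
  rw [ae_restrict_iff' (D.isCompact_dom i).measurableSet]
  -- `simple` compares interior parameters only, so an interior parameter may still land on an edge
  -- of some piece. In a chart, u is recovered from its image as `tail (c.e.symm _)`; such u
  -- therefore lie in images of the null sets `frontier (D.dom j)` under differentiable maps from
  -- ℝ^n to ℝ^n, which are null.
  have hZ : volume {u | u ∈ interior (D.dom i) ∧ D.param i u ∈ D.edges} = 0 := by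
    refine measure_null_of_locally_null _ fun u₀ hu₀ => ?_
    obtain ⟨c, hc⟩ := exists_chart hu₀.1
    refine ⟨Metric.ball u₀ c.r ∩ {u | u ∈ interior (D.dom i) ∧ D.param i u ∈ D.edges},
      Filter.inter_mem (mem_nhdsWithin_of_mem_nhds (Metric.ball_mem_nhds _ c.r_pos))
        self_mem_nhdsWithin, ?_⟩
    refine measure_mono_null (t := ⋃ j, (fun v => tail (c.e.symm (D.param j v))) ''
      (frontier (D.dom j) ∩ D.param j ⁻¹' c.e.target)) ?_ (measure_iUnion_null fun j => ?_)
    · rintro u ⟨hu, -, hue⟩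
      obtain ⟨j, v, hv, hvu⟩ := Set.mem_iUnion.1 hue
      obtain ⟨h1, h2⟩ := c.param_mem_target hu
      refine Set.mem_iUnion_of_mem j ⟨v, ⟨hv, ?_⟩, ?_⟩
      · rw [Set.mem_preimage, hvu]
        exact h1
      · simp only [hvu, h2]
    · refine addHaar_image_eq_zero_of_differentiableOn_of_addHaar_eq_zero volume
        (fun v hv => ?_) (measure_mono_null Set.inter_subset_left (D.volume_frontier_dom j))
      have h1 : DifferentiableAt ℝ (D.param j) v :=
        (contDiffAt (frontier_dom_subset j hv.1)).differentiableAt (by simp)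
      have h2 : DifferentiableAt ℝ c.e.symm (D.param j v) :=
        (c.contDiffAt_symm _ hv.2).differentiableAt (by simp)
      exact (tail.differentiableAt.comp v (h2.comp v h1)).differentiableWithinAt
  filter_upwards [measure_eq_zero_iff_ae_notMem.1 hZ,
    measure_eq_zero_iff_ae_notMem.1 (D.volume_frontier_dom i)] with u h1 h2 hu he
  refine h1 ⟨?_, he⟩
  by_contra hi
  exact h2 ⟨subset_closure hu, hi⟩

theorem hasSmallCutoffs_edges : HasSmallCutoffs D.edges D.edges := by
  refine HasSmallCutoffs.iUnion fun i => ?_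
  obtain ⟨L, hL⟩ := exists_lipschitzOnWith_of_contDiffAt (isCompact_frontier_dom i)
    fun u hu => contDiffAt (frontier_dom_subset i hu)
  exact hasSmallCutoffs_image (isCompact_frontier_dom i) (D.volume_frontier_dom i) hL
    (Set.subset_iUnion (fun i => D.param i '' frontier (D.dom i)) i)

variable {F : E (n + 1) → Fin (n + 1) → V} {g : E (n + 1) → V}

variable (D F g) in
/-- The divergence formula, tested with `ψ`. -/
def TestFormula (ψ : E (n + 1) → ℝ) : Prop :=
  ∫ x in D.carrier, (ψ x • g x + pairing (F x) (fderiv ℝ ψ x)) =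
    ∑ i, ∫ u in D.dom i, ψ (D.param i u) • D.flux F i u

/-- Inside Ω the formula is the definition of the weak divergence, outside the closure both sides
vanish, and at a boundary point off the edges it is the formula in a chart, provided that no other
part of the boundary comes near. -/
theorem exists_nhds_testFormula [CompleteSpace V] (hF : Continuous F)
    (hg : IntegrableOn g D.carrier) (hdiv : IsWeakDiv D.carrier F g) {x : E (n + 1)}
    (hx : x ∉ D.edges) : ∃ U, IsOpen U ∧ x ∈ U ∧ ∀ ψ : E (n + 1) → ℝ, ContDiff ℝ 1 ψ →
      HasCompactSupport ψ → tsupport ψ ⊆ U → D.TestFormula F g ψ := by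
  have hzero : ∀ {ψ : E (n + 1) → ℝ} {U : Set (E (n + 1))}, tsupport ψ ⊆ U → ∀ {y}, y ∉ U →
      ψ y = 0 := fun h y hy => image_eq_zero_of_notMem_tsupport fun h' => hy (h h')
  by_cases hxΩ : x ∈ D.carrier
  · refine ⟨D.carrier, D.isOpen, hxΩ, fun ψ hψ hψc hψs => ?_⟩
    rw [TestFormula, hdiv ψ hψ hψc hψs, eq_comm]
    refine Finset.sum_eq_zero fun i _ => setIntegral_eq_zero_of_forall_eq_zero fun u hu => ?_
    rw [hzero hψs (param_notMem_carrier hu), zero_smul]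
  by_cases hxc : x ∈ closure D.carrier
  swap
  · refine ⟨(closure D.carrier)ᶜ, isClosed_closure.isOpen_compl, hxc, fun ψ hψ hψc hψs => ?_⟩
    rw [TestFormula, setIntegral_eq_zero_of_forall_eq_zero, eq_comm]
    · refine Finset.sum_eq_zero fun i _ => setIntegral_eq_zero_of_forall_eq_zero fun u hu => ?_
      rw [hzero hψs (fun h => h (frontier_subset_closure (param_mem_frontier hu))), zero_smul]
    · intro y hy
      have hy' : y ∉ tsupport ψ := fun h => hψs h (subset_closure hy)
      rw [fderiv_of_notMem_tsupport (𝕜 := ℝ) hy', pairing_zero,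
        image_eq_zero_of_notMem_tsupport hy', zero_smul, add_zero]
  have hxf : x ∈ frontier D.carrier := by
    rw [D.isOpen.frontier_eq]
    exact ⟨hxc, hxΩ⟩
  rw [D.frontier_eq] at hxf
  obtain ⟨i, u₀, hu₀, rfl⟩ := Set.mem_iUnion.1 hxf
  have hui := mem_interior_of_param_notMem_edges hu₀ hx
  obtain ⟨c, hc⟩ := exists_chart hui
  classical
  -- `B` collects the parameters seen by the chart, and `C` is the image of all others. Every
  -- parameter of a point off the edges is interior, so `simple` keeps the point out of the compact
  -- set `C`, and near it only the piece i contributes.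
  let B : Fin D.pieces → Set (E n) := fun j => if j = i then Metric.ball u₀ c.r else ∅
  have hBo : ∀ j, IsOpen (B j) := fun j => by
    by_cases h : j = i
    · simp only [B, if_pos h, Metric.isOpen_ball]
    · simp only [B, if_neg h, isOpen_empty]
  let C : Set (E (n + 1)) := ⋃ j, D.param j '' (D.dom j \ B j)
  have hC : IsCompact C := isCompact_iUnion fun j =>
    ((D.isCompact_dom j).diff (hBo j)).image_of_continuousOn
      ((continuousOn_param j).mono Set.sdiff_subset)
  have hxC : D.param i u₀ ∉ C := by
    intro h
    obtain ⟨j, v, ⟨hv, hvB⟩, hvu⟩ := Set.mem_iUnion.1 h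
    have hvi := mem_interior_of_param_notMem_edges hv (hvu ▸ hx)
    obtain ⟨rfl, rfl⟩ := D.simple j i v hvi u₀ hui hvu
    simp [B, c.r_pos] at hvB
  refine ⟨c.e.target ∩ Cᶜ, c.e.open_target.inter hC.isClosed.isOpen_compl,
    ⟨(c.param_mem_target (Metric.mem_ball_self c.r_pos)).1, hxC⟩, fun ψ hψ hψc hψs => ?_⟩
  rw [TestFormula, c.integral_eq D.isOpen hF hg hdiv hψ hψc (hψs.trans Set.inter_subset_left)]
  have hoff : ∀ j, ∀ v ∈ D.dom j \ B j, ψ (D.param j v) • D.flux F j v = 0 := fun j v hv => by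
    rw [hzero hψs fun h => h.2 (Set.mem_iUnion_of_mem j ⟨v, hv, rfl⟩), zero_smul]
  rw [Finset.sum_eq_single i]
  · rw [setIntegral_eq_of_subset_of_forall_sdiff_eq_zero (s := Metric.ball u₀ c.r)
      (D.isCompact_dom i).measurableSet (hc.trans interior_subset)]
    · rfl
    · intro v hv
      exact hoff i v (by simpa [B] using hv)
  · intro j _ hj
    exact setIntegral_eq_zero_of_forall_eq_zero fun v hv => hoff j v (by simp [B, hj, hv])
  · simp

/-- The divergence formula for test functions which vanish near the edges. -/
theorem testFormula [CompleteSpace V] (hF : Continuous F)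
    (hg : IntegrableOn g D.carrier) (hdiv : IsWeakDiv D.carrier F g) {ψ : E (n + 1) → ℝ}
    (hψ : ContDiff ℝ 1 ψ) (hψc : HasCompactSupport ψ) (hψe : ∀ x ∈ tsupport ψ, x ∉ D.edges) :
    D.TestFormula F g ψ := by
  have hloc := fun x : (D.edgesᶜ : Set (E (n + 1))) => exists_nhds_testFormula hF hg hdiv x.2
  choose U hU hxU hUψ using hloc
  let W : tsupport ψ → Set (E (n + 1)) := fun x => U ⟨x.1, hψe x.1 x.2⟩
  obtain ⟨t, ht⟩ := hψc.isCompact.elim_finite_subcover W (fun x => hU _)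
    fun x hx => Set.mem_iUnion_of_mem ⟨x, hx⟩ (hxU _)
  -- The formula is linear in ψ, so it suffices to split ψ into finitely many functions with
  -- supports in the good neighbourhoods.
  obtain ⟨f, hf⟩ := SmoothPartitionOfUnity.exists_isSubordinate
    (modelWithCornersSelf ℝ (E (n + 1))) hψc.isClosed (fun x : t => W x.1) (fun x => hU _)
    (by simpa only [Set.iUnion_coe_set, Set.iUnion_subtype] using ht)
  let θ : t → E (n + 1) → ℝ := fun k x => f k x * ψ x
  have hθ : ∀ k, ContDiff ℝ 1 (θ k) := fun k =>
    ((f k).contMDiff.contDiff.of_le (by simp)).mul hψ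
  have hθc : ∀ k, HasCompactSupport (θ k) := fun k => hψc.mul_left
  have hθf : ∀ k, D.TestFormula F g (θ k) := fun k =>
    hUψ _ _ (hθ k) (hθc k) (tsupport_mul_subset_left.trans (hf k))
  have hsum : ∀ x, ψ x = ∑ k, θ k x := fun x => by
    by_cases hx : x ∈ tsupport ψ
    · have := f.sum_eq_one hx
      rw [finsum_eq_sum_of_fintype] at this
      rw [← Finset.sum_mul, this, one_mul]
    · simp [θ, image_eq_zero_of_notMem_tsupport hx]
  have hd : ∀ x, fderiv ℝ ψ x = ∑ k, fderiv ℝ (θ k) x := fun x => by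
    have h := fderiv_fun_sum (u := Finset.univ) fun k _ => (hθ k).differentiable (by simp) x
    exact (congrArg (fun η => fderiv ℝ η x) (funext hsum)).trans h
  have h1 : ∀ x, ψ x • g x + pairing (F x) (fderiv ℝ ψ x) =
      ∑ k, (θ k x • g x + pairing (F x) (fderiv ℝ (θ k) x)) := fun x => by
    rw [hd, pairing_sum, Finset.sum_add_distrib, ← Finset.sum_smul, hsum]
  have h2 : ∀ i u, ψ (D.param i u) • D.flux F i u =
      ∑ k, θ k (D.param i u) • D.flux F i u := fun i u => by
    rw [← Finset.sum_smul, hsum]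
  have hi : ∀ k, IntegrableOn (fun x => θ k x • g x + pairing (F x) (fderiv ℝ (θ k) x))
      D.carrier := fun k => (integrableOn_smul_test hg (hθ k).continuous (hθc k)).add
    (integrable_pairing_fderiv hF (hθ k) (hθc k)).integrableOn
  rw [TestFormula]
  simp only [h1, h2]
  rw [integral_finsetSum _ fun k _ => hi k, Finset.sum_congr rfl fun k _ => hθf k,
    Finset.sum_comm]
  refine Finset.sum_congr rfl fun i _ => ?_
  rw [integral_finsetSum]
  intro k _
  exact (((hθ k).continuous.comp_continuousOn (continuousOn_param i)).smul
    (continuousOn_flux hF.continuousOn i)).integrableOn_compact (D.isCompact_dom i)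

/-- **Divergence theorem** for continuous vector fields with integrable weak divergence. -/
theorem integral_weakDiv [CompleteSpace V] (hF : Continuous F)
    (hg : IntegrableOn g D.carrier) (hdiv : IsWeakDiv D.carrier F g) :
    ∫ x in D.carrier, g x = ∑ i, ∫ u in D.dom i, D.flux F i u := by
  have hε : ∀ m : ℕ, (0 : ℝ) < 1 / (m + 1) := fun m => by positivity
  choose b hb hbc hb0 hbU hbS hbi using fun m : ℕ => D.hasSmallCutoffs_edges _ (hε m)
  choose U hU heU hbU using hbU
  obtain ⟨R, hR, hΩR⟩ : ∃ R > 0, closure D.carrier ⊆ Metric.ball 0 R := by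
    obtain ⟨R, hR, h⟩ := D.isCompact_closure_carrier.isBounded.exists_pos_norm_lt
    exact ⟨R, hR, fun x hx => by simpa using h x hx⟩
  let η : ContDiffBump (0 : E (n + 1)) := ⟨R, R + 1, hR, by linarith⟩
  -- Where b = 0 the argument is -2 and the step is 1; where b ≥ 1 the argument is at least -1 and
  -- the step is 0. The factor η, equal to 1 on the closure of Ω, only provides compact support.
  let χ : ℕ → E (n + 1) → ℝ := fun m x => stepDown (b m x - 2)
  let ψ : ℕ → E (n + 1) → ℝ := fun m x => η x * χ m x
  have hχ : ∀ m, ContDiff ℝ 1 (χ m) := fun m =>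
    (contDiff_stepDown.of_le (by simp)).comp ((hb m).sub contDiff_const)
  have hψ : ∀ m, ContDiff ℝ 1 (ψ m) := fun m => η.contDiff.mul (hχ m)
  have hψc : ∀ m, HasCompactSupport (ψ m) := fun m => η.hasCompactSupport.mul_right
  have hψ1 : ∀ m x, ‖ψ m x‖ ≤ 1 := fun m x => by
    rw [Real.norm_of_nonneg (mul_nonneg η.nonneg (stepDown_nonneg _))]
    exact mul_le_one₀ η.le_one (stepDown_nonneg _) (stepDown_le_one _)
  have hη1 : ∀ x ∈ Metric.ball (0 : E (n + 1)) R, η x = 1 := fun x hx =>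
    η.one_of_mem_closedBall (Metric.ball_subset_closedBall hx)
  have hψe : ∀ m, ∀ x ∈ tsupport (ψ m), x ∉ D.edges := fun m x hx he => by
    refine notMem_tsupport_iff_eventuallyEq.2 ?_ hx
    filter_upwards [(hU m).mem_nhds (heU m he)] with y hy
    simp only [ψ, χ, Pi.zero_apply]
    rw [stepDown_eq_zero (by linarith [hbU m y hy]), mul_zero]
  have hlimψ : ∀ x ∈ closure D.carrier, x ∉ D.edges →
      Tendsto (fun m => ψ m x) atTop (𝓝 1) := fun x hx he => by
    obtain ⟨δ, hδ, hδe⟩ := Metric.isOpen_iff.1 D.isCompact_edges.isClosed.isOpen_compl x he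
    refine tendsto_const_nhds.congr' ?_
    filter_upwards [tendsto_one_div_add_atTop_nhds_zero_nat.eventually (gt_mem_nhds hδ)] with m hm
    have hbm : b m x = 0 := by
      by_contra h
      obtain ⟨z, hz, hxz⟩ := Metric.mem_thickening_iff.1 (hbS m x h)
      refine hδe (Metric.mem_ball'.2 (hxz.trans hm)) hz
    simp only [ψ, χ]
    rw [hbm, hη1 x (hΩR hx), stepDown_eq_one (by norm_num), one_mul]
  have hform := fun m => D.testFormula hF hg hdiv (hψ m) (hψc m) (hψe m)
  -- the interior terms
  have hlim1 : Tendsto (fun m => ∫ x in D.carrier, ψ m x • g x) atTop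
      (𝓝 (∫ x in D.carrier, g x)) := by
    refine tendsto_integral_filter_of_dominated_convergence (fun x => ‖g x‖)
      (Eventually.of_forall fun m =>
        (integrableOn_smul_test hg (hψ m).continuous (hψc m)).aestronglyMeasurable)
      (Eventually.of_forall fun m => ae_of_all _ fun x => ?_) hg.norm
      ((ae_restrict_iff' D.isOpen.measurableSet).2 (ae_of_all _ fun x hx => ?_))
    · rw [norm_smul]
      exact mul_le_of_le_one_left (norm_nonneg _) (hψ1 m x)
    · have he : x ∉ D.edges := fun he => by
        have := edges_subset_frontier he
        rw [D.isOpen.frontier_eq] at this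
        exact this.2 hx
      simpa using (hlimψ x (subset_closure hx) he).smul_const (g x)
  obtain ⟨C, hC⟩ := hasCompactSupport_stepKernel.exists_bound_of_continuous continuous_stepKernel
  obtain ⟨M, hM⟩ := D.isCompact_closure_carrier.exists_bound_of_continuousOn
    (f := fun x => ∑ i, ‖F x i‖)
    (continuous_finsetSum _ fun i _ => ((continuous_apply i).comp hF).norm).continuousOn
  have hC0 : 0 ≤ C := (norm_nonneg _).trans (hC 0)
  have hdχ : ∀ m x, ‖fderiv ℝ (χ m) x‖ ≤ C * ‖fderiv ℝ (b m) x‖ := fun m x => by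
    have h1 := (hasDerivAt_stepDown (b m x - 2)).comp_hasFDerivAt x
      (((hb m).differentiable (by simp) x).hasFDerivAt.sub_const 2)
    rw [show fderiv ℝ (χ m) x = _ from h1.fderiv, norm_smul, norm_neg]
    gcongr
    exact hC _
  have hdψ : ∀ m, ∀ x ∈ D.carrier, fderiv ℝ (ψ m) x = fderiv ℝ (χ m) x := fun m x hx => by
    refine Filter.EventuallyEq.fderiv_eq ?_
    filter_upwards [Metric.isOpen_ball.mem_nhds (hΩR (subset_closure hx))] with y hy
    simp only [ψ, hη1 y hy, one_mul]
  -- F is bounded on the closure, and the gradient of χ_m is at most a constant times that of b_m,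
  -- whose integral is at most 1/(m+1).
  have hlim2 : Tendsto (fun m => ∫ x in D.carrier, pairing (F x) (fderiv ℝ (ψ m) x)) atTop
      (𝓝 0) := by
    refine squeeze_zero_norm (a := fun m : ℕ => |M| * C * (1 / (m + 1))) (fun m => ?_) ?_
    · calc ‖∫ x in D.carrier, pairing (F x) (fderiv ℝ (ψ m) x)‖
          ≤ ∫ x in D.carrier, |M| * C * ‖fderiv ℝ (b m) x‖ := by
            refine norm_integral_le_of_norm_le
              ((integrable_norm_fderiv (hb m) (hbc m)).integrableOn.const_mul _)
              ((ae_restrict_iff' D.isOpen.measurableSet).2 (ae_of_all _ fun x hx => ?_))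
            rw [hdψ m x hx]
            have hMx : ∑ i, ‖F x i‖ ≤ |M| :=
              (le_abs_self _).trans ((hM x (subset_closure hx)).trans (le_abs_self M))
            calc ‖pairing (F x) (fderiv ℝ (χ m) x)‖
                ≤ ‖fderiv ℝ (χ m) x‖ * ∑ i, ‖F x i‖ := norm_pairing_le _ _
              _ ≤ (C * ‖fderiv ℝ (b m) x‖) * |M| := by
                  gcongr
                  exact hdχ m x
              _ = |M| * C * ‖fderiv ℝ (b m) x‖ := by ring
        _ ≤ ∫ x, |M| * C * ‖fderiv ℝ (b m) x‖ :=
            setIntegral_le_integral ((integrable_norm_fderiv (hb m) (hbc m)).const_mul _)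
              (ae_of_all _ fun x => by positivity)
        _ = |M| * C * ∫ x, ‖fderiv ℝ (b m) x‖ := integral_const_mul _ _
        _ ≤ |M| * C * (1 / (m + 1)) := by
            gcongr
            exact hbi m
    · simpa using tendsto_one_div_add_atTop_nhds_zero_nat.const_mul (|M| * C)
  -- the boundary terms
  have hlim3 : Tendsto (fun m => ∑ i, ∫ u in D.dom i, ψ m (D.param i u) • D.flux F i u) atTop
      (𝓝 (∑ i, ∫ u in D.dom i, D.flux F i u)) := by
    refine tendsto_finsetSum _ fun i _ => ?_
    have hw := continuousOn_flux (D := D) hF.continuousOn i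
    refine tendsto_integral_filter_of_dominated_convergence (fun u => ‖D.flux F i u‖)
      (Eventually.of_forall fun m => ?_)
      (Eventually.of_forall fun m => ae_of_all _ fun u => ?_)
      (hw.integrableOn_compact (D.isCompact_dom i)).norm ?_
    · exact (((hψ m).continuous.comp_continuousOn (continuousOn_param i)).smul
        hw).aestronglyMeasurable (D.isCompact_dom i).measurableSet
    · rw [norm_smul]
      exact mul_le_of_le_one_left (norm_nonneg _) (hψ1 m _)
    -- The cutoffs converge to 1 only off the edges, which almost every parameter avoids.
    · filter_upwards [D.ae_param_notMem_edges i,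
        ae_restrict_mem (D.isCompact_dom i).measurableSet] with u hu hui
      simpa using (hlimψ _ (frontier_subset_closure (param_mem_frontier hui)) hu).smul_const
        (D.flux F i u)
  have hlim4 := (hlim1.add hlim2).congr
      (f₂ := fun m => ∑ i, ∫ u in D.dom i, ψ m (D.param i u) • D.flux F i u) fun m => by
    rw [← integral_add (integrableOn_smul_test hg (hψ m).continuous (hψc m))
      (integrable_pairing_fderiv hF (hψ m) (hψc m)).integrableOn]
    exact hform m
  rw [add_zero] at hlim4
  exact tendsto_nhds_unique hlim4 hlim3

end AdmissibleDomain

/-! ### Functions continuous up to the boundary, and boundary integrals as fluxes -/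

namespace AdmissibleDomain

variable {n : ℕ} {D : AdmissibleDomain n}

theorem continuousOn_fieldOf {V : Type*} [NormedAddCommGroup V] [NormedSpace ℝ V] {d : ℕ}
    {ι : Type*} [Fintype ι] {Y : ι → E d → E d} {f : ι → E d → V} {s : Set (E d)}
    (hY : ∀ k, Continuous (Y k)) (hf : ∀ k, ContinuousOn (f k) s) :
    ContinuousOn (fieldOf Y f) s :=
  continuousOn_pi.2 fun i => continuousOn_finsetSum _ fun k _ =>
    ((EuclideanSpace.proj (𝕜 := ℝ) i : E d →L[ℝ] ℝ).continuous.comp (hY k)).continuousOn.smul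
      (hf k)

/-- The divergence formula for `∑ f_k Y_k`, where the fields `Y_k` are divergence free. -/
theorem integral_sum_fderiv {𝕜 : Type*} [RCLike 𝕜] {ι : Type*} [Fintype ι]
    {Y : ι → E (n + 1) → E (n + 1)} (hY : ∀ k, Continuous (Y k))
    (hdiv : ∀ k (h : E (n + 1) → 𝕜), ContDiff ℝ 1 h → HasCompactSupport h →
      ∫ x, fderiv ℝ h x (Y k x) = 0)
    {f : ι → E (n + 1) → 𝕜} (hf : ∀ k, ContDiffOn ℝ 1 (f k) D.carrier)
    (hfc : ∀ k, ContinuousOn (f k) (closure D.carrier))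
    (hi : IntegrableOn (fun x => ∑ k, fderiv ℝ (f k) x (Y k x)) D.carrier) :
    ∫ x in D.carrier, ∑ k, fderiv ℝ (f k) x (Y k x) =
      ∑ i, ∫ u in D.dom i, D.flux (fieldOf Y f) i u := by
  -- Tietze extension makes the field continuous on the whole space. Only its values on the closure
  -- of Ω matter, and the divergence is still computed from f.
  have hext : ∀ k, ∃ h : E (n + 1) → 𝕜, Continuous h ∧ Set.EqOn h (f k) (closure D.carrier) :=
    fun k => by
      obtain ⟨h, hh⟩ := ContinuousMap.exists_restrict_eq isClosed_closure
        (⟨_, (hfc k).domRestrict⟩ : C(closure D.carrier, 𝕜))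
      exact ⟨h, h.continuous, fun x hx => DFunLike.congr_fun hh ⟨x, hx⟩⟩
  choose h hh hhf using hext
  have hfield : ∀ x ∈ closure D.carrier, fieldOf Y h x = fieldOf Y f x := fun x hx => by
    ext i
    exact Finset.sum_congr rfl fun k _ => by rw [hhf k hx]
  have hweak : IsWeakDiv D.carrier (fieldOf Y h) fun x => ∑ k, fderiv ℝ (f k) x (Y k x) := by
    intro ζ hζ hc hs
    rw [← isWeakDiv_fieldOf hY hdiv D.isOpen hf ζ hζ hc hs]
    refine setIntegral_congr_fun D.isOpen.measurableSet fun x hx => ?_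
    simp only [hfield x (subset_closure hx)]
  rw [integral_weakDiv (continuous_fieldOf hY hh) hi hweak]
  refine Finset.sum_congr rfl fun i _ =>
    setIntegral_congr_fun (D.isCompact_dom i).measurableSet fun u hu => ?_
  simp only [flux, hfield _ (frontier_subset_closure (param_mem_frontier hu))]

theorem alternatingMap_sum_apply {V W ι κ : Type*} [AddCommGroup V] [Module ℝ V] [AddCommGroup W]
    [Module ℝ W] (s : Finset κ) (η : κ → AlternatingMap ℝ W V ι) (v : ι → W) :
    (∑ k ∈ s, η k) v = ∑ k ∈ s, η k v :=
  map_sum (AddMonoidHom.mk (ZeroHom.mk (fun ξ : AlternatingMap ℝ W V ι => ξ v) rfl)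
    fun _ _ => rfl) η s

/-- `contractVol` evaluated on the tangent vectors and `fluxCovector` evaluated on Y_k are the same
determinant, with Y_k in the first slot. -/
theorem pullback_sum_mulForm_contractVol {V : Type*} [NormedAddCommGroup V] [NormedSpace ℝ V]
    {ι : Type*} [Fintype ι] (Y : ι → E (n + 1) → E (n + 1)) (f : ι → E (n + 1) → V)
    (i : Fin D.pieces) :
    D.pullback (fun x => ∑ k, mulForm (f k) (contractVol (Y k)) x) i =
      D.flux (fieldOf Y f) i := by
  ext u
  rw [pullback, flux, pairing_fieldOf, alternatingMap_sum_apply]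
  rfl

theorem pullback_mulForm_contractVol {V : Type*} [NormedAddCommGroup V] [NormedSpace ℝ V]
    (Y : E (n + 1) → E (n + 1)) (f : E (n + 1) → V) (i : Fin D.pieces) :
    D.pullback (mulForm f (contractVol Y)) i =
      D.flux (fieldOf (fun _ : Unit => Y) fun _ => f) i := by
  rw [← pullback_sum_mulForm_contractVol]
  simp

end AdmissibleDomain

end Carnot

end

open Carnot Carnot.AdmissibleDomain in
theorem proposition2p2 {𝕜 : Type*} [RCLike 𝕜] {n : ℕ} (G : Carnot.CarnotGroup n) :
    ∃ a : G.Horizontal → G.Vertical → MvPolynomial (Fin (n + 1)) ℝ,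
      -- `a k i` is homogeneous of degree `l - 1` and depends on `x^{(1)}, …, x^{(l-1)}` only
      (∀ k i, (a k i).IsWeightedHomogeneous G.weight (G.weight i - 1) ∧
        ∀ j ∈ (a k i).vars, G.weight j < G.weight i) ∧
      -- `X_k = ∂/∂x_k + ∑ a_{k,i} ∂/∂x_i`
      (∀ k x, G.X k x = Carnot.stdVec k.1 +
        ∑ i : G.Vertical, MvPolynomial.eval (fun j => x j) (a k i) • Carnot.stdVec i.1) ∧
      -- the explicit form of `⟨X_k, dν⟩` (positions are counted from `0` here)
      (∀ k x, Carnot.contractVol (G.X k) x =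
        (-1 : ℝ) ^ (k.1 : ℕ) •
          Carnot.wedge (fun j : Fin n => G.coframe a x (k.1.succAbove j))) ∧
      -- the divergence formulae
      ∀ (Ω : Carnot.AdmissibleDomain n) (f : G.Horizontal → Carnot.E (n + 1) → 𝕜),
        (∀ k, ContDiffOn ℝ 1 (f k) Ω.carrier) →
        (∀ k, ContinuousOn (f k) (closure Ω.carrier)) →
        (∀ k, Ω.FormIntegrable (Carnot.mulForm (f k) (Carnot.contractVol (G.X k)))) ∧
        (∀ k, MeasureTheory.IntegrableOn (G.derivX k (f k)) Ω.carrier →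
          ∫ x in Ω.carrier, G.derivX k (f k) x =
            Ω.boundaryIntegral (Carnot.mulForm (f k) (Carnot.contractVol (G.X k)))) ∧
        (MeasureTheory.IntegrableOn (fun x => ∑ k, G.derivX k (f k) x) Ω.carrier →
          ∫ x in Ω.carrier, ∑ k, G.derivX k (f k) x =
            Ω.boundaryIntegral
              (fun x => ∑ k, Carnot.mulForm (f k) (Carnot.contractVol (G.X k)) x)) := by
  obtain ⟨a, ha, haX⟩ := exists_isXCoeff G.toHomogeneousGroup
  have hX : ∀ k, Continuous (G.X k) := fun k => (G.contDiff_X k).continuous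
  refine ⟨a, ha, haX, G.contractVol_X haX, fun Ω f hf hfc => ⟨fun k i => ?_, fun k hi => ?_,
    fun hi => ?_⟩⟩
  · rw [pullback_mulForm_contractVol]
    exact (continuousOn_flux (continuousOn_fieldOf (fun _ => hX k)
      fun _ => hfc k) i).integrableOn_compact (Ω.isCompact_dom i)
  -- Only X_k f_k is assumed integrable here, so the divergence formula is applied to a family with
  -- one member.
  · have hi' : IntegrableOn (fun x => ∑ _ : Unit, G.derivX k (f k) x) Ω.carrier := by
      simpa using hi
    have h := integral_sum_fderiv (D := Ω) (ι := Unit) (Y := fun _ => G.X k) (f := fun _ => f k)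
      (fun _ => hX k) (fun _ _ => integral_fderiv_X_eq_zero G.toHomogeneousGroup k)
      (fun _ => hf k) (fun _ => hfc k) hi'
    simp only [boundaryIntegral, pullback_mulForm_contractVol, ← h]
    simp [CarnotGroup.derivX]
  · simp only [boundaryIntegral, pullback_sum_mulForm_contractVol]
    exact integral_sum_fderiv (D := Ω) hX
      (fun k _ => integral_fderiv_X_eq_zero G.toHomogeneousGroup k) hf hfc hi
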